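/- Let $K$ be an infinite field, let $n,l\ge 1$ be integers, and let $S=K[x_1,\dots,x_n]$ carry the lexicographic monomial order with $x_1<x_2<\cdots<x_n$. Let $[P_{n+l-1}]_{\ge l}$ be the set of partitions $\lambda=(\lambda_1\ge\lambda_2\ge\cdots)$ of $n+l-1$ with $\lambda_1\ge l$, and let $\unlhd$ be the dominance order on partitions ($\rho\unlhd\lambda$ iff $\rho_1+\cdots+\rho_i\le\lambda_1+\cdots+\lambda_i$ for all $i$). For $\lambda\in[P_{n+l-1}]_{\ge l}$ let $\mathrm{Tab}(\lambda,l)$ be the set of fillings $T$ of the Young diagram of $\lambda$ in which each of $1,\dots,n-1$ appears exactly once and $n$ appears exactly $l$ times, no two copies of $n$ being in the same column. Let $\mathrm{STab}(\lambda,l)\subset\mathrm{Tab}(\lambda,l)$ be the subset of standard tableaux, i.e. those whose columns are increasing from top to bottom and whose rows are non-decreasing from left to right. The Specht polynomial $f_T\in S$ of $T$ is the product of all $x_a-x_b$ where $a,b$ are the entries of two squares in the same column of $T$, the square of $a$ being above that of $b$. Put $I_{\lambda,l}:=(f_T\mid T\in\mathrm{Tab}(\lambda,l))\subset S$. Then,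 for every $\lambda\in[P_{n+l-1}]_{\ge l}$, the set $$\{\,f_T \mid T\in\mathrm{STab}(\rho,l),\ \rho\in[P_{n+l-1}]_{\ge l},\ \rho\unlhd\lambda\,\}$$ is a Gröbner basis of $I_{\lambda,l}$, that is, a finite set of nonzero elements of $I_{\lambda,l}$ whose initial monomials generate the initial ideal of $I_{\lambda,l}$. -/

import Mathlib

namespace SpechtIdeals

open MvPolynomial

/-- The lexicographic monomial order on `x_0, …, x_{n-1}` with `x_0 < x_1 < ⋯ < x_{n-1}`
(Mathlib's `MonomialOrder.lex` on `Fin n` has `x_0 > x_1 > ⋯`, so the index set is reversed). -/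
noncomputable def lexOrder (n : ℕ) : MonomialOrder (Fin n) where
  syn := Lex ((Fin n)ᵒᵈ →₀ ℕ)
  toSyn :=
    (Finsupp.domCongr (M := ℕ) (OrderDual.toDual (α := Fin n))).trans
      { toEquiv := toLex
        map_add' := toLex_add }
  toSyn_monotone := by
    intro a b h
    exact Finsupp.toLex_monotone (fun i => h (OrderDual.ofDual i))

/-- `a` is smaller than `b` iff `a i < b i` at the largest index `i` where they differ. -/
theorem lexOrder_lt_iff {n : ℕ} {a b : Fin n →₀ ℕ} :
    (lexOrder n).toSyn a < (lexOrder n).toSyn b ↔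
      ∃ i, (∀ j, i < j → a j = b j) ∧ a i < b i :=
  Iff.rfl

/-- The initial monomial `in(f)` (meaningful for `f ≠ 0`). -/
noncomputable def initialMonomial {σ K : Type*} [Field K] (m : MonomialOrder σ)
    (f : MvPolynomial σ K) : MvPolynomial σ K :=
  monomial (m.degree f) 1

/-- `G` is a Gröbner basis of the ideal `I`: a finite set of nonzero elements of `I` whose
initial monomials generate the initial ideal `in(I) = (in(f) : 0 ≠ f ∈ I)`. -/
structure IsGroebnerBasis {σ K : Type*} [Field K] (m : MonomialOrder σ)
    (I : Ideal (MvPolynomial σ K)) (G : Set (MvPolynomial σ K)) : Prop where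
  finite : G.Finite
  ne_zero : ∀ g ∈ G, g ≠ 0
  mem : ∀ g ∈ G, g ∈ I
  span_initial :
    Ideal.span (initialMonomial m '' G) =
      Ideal.span (initialMonomial m '' {f | f ∈ I ∧ f ≠ 0})

/-- The set `[P_{n+l-1}]_{≥ l}` of partitions `lam` of `n + l - 1` with `lam_1 ≥ l`,
as Young diagrams. -/
def partitionsGE (n l : ℕ) : Set YoungDiagram :=
  {lam | lam.card = n + l - 1 ∧ l ≤ lam.rowLen 0}

/-- The dominance order on partitions of the same number, `mu ⊴ lam`:
`mu_1 + ⋯ + mu_i ≤ lam_1 + ⋯ + lam_i` for all `i`. -/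
def Dominated (mu lam : YoungDiagram) : Prop :=
  ∀ i : ℕ, ∑ k ∈ Finset.range i, mu.rowLen k ≤ ∑ k ∈ Finset.range i, lam.rowLen k

/-- `Tab(lam, l)`: the fillings of the cells `(row, column)` of `lam` by the multiset in which
the largest letter `n` occurs `l` times and `1, …, n-1` once each, such that no two copies of `n`
are in the same column. The letter `k` is represented by the element `k - 1` of `Fin n`. -/
structure Tab (n l : ℕ) (lam : YoungDiagram) where
  entry : {c : ℕ × ℕ // c ∈ lam.cells} → Fin n
  content : ∀ k : Fin n,
    (Finset.univ.filter fun c => entry c = k).card = if (k : ℕ) + 1 = n then l else 1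
  col_injective : ∀ c d : {c : ℕ × ℕ // c ∈ lam.cells},
    c.1.2 = d.1.2 → entry c = entry d → c = d

/-- `STab(lam, l)`: every column increases from top to bottom, and every row is non-decreasing
from left to right. -/
structure Tab.IsStandard {n l : ℕ} {lam : YoungDiagram} (T : Tab n l lam) : Prop where
  col_strict : ∀ c d : {c : ℕ × ℕ // c ∈ lam.cells},
    c.1.2 = d.1.2 → c.1.1 < d.1.1 → T.entry c < T.entry d
  row_weak : ∀ c d : {c : ℕ × ℕ // c ∈ lam.cells},
    c.1.1 = d.1.1 → c.1.2 < d.1.2 → T.entry c ≤ T.entry d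

/-- The Specht polynomial `f_T`: the product of `x_a - x_b` over all pairs of cells in the same
column, `a` being the entry of the upper cell and `b` that of the lower cell. -/
noncomputable def Tab.specht (K : Type*) [Field K] {n l : ℕ} {lam : YoungDiagram}
    (T : Tab n l lam) : MvPolynomial (Fin n) K :=
  ∏ p : {c : ℕ × ℕ // c ∈ lam.cells} × {c : ℕ × ℕ // c ∈ lam.cells} with
      p.1.1.2 = p.2.1.2 ∧ p.1.1.1 < p.2.1.1,
    (X (T.entry p.1) - X (T.entry p.2))

/-- The ideal `I_{lam, l} = (f_T : T ∈ Tab(lam, l))`. -/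
noncomputable def spechtIdeal (K : Type*) [Field K] (n l : ℕ) (lam : YoungDiagram) :
    Ideal (MvPolynomial (Fin n) K) :=
  Ideal.span {f | ∃ T : Tab n l lam, f = T.specht K}

end SpechtIdeals

/-! ### Dominance order on column lengths and horizontal strips -/

namespace SpechtIdeals

open Finset

/-! Membership. If `rho ⊴ lam`, one gets from `rho` to `lam` by moving single boxes from a longer
column to a shorter one. Each move is matched by an exchange relation between products of
Vandermonde products, a consequence of Lagrange interpolation (`vandermondeProd_mul_mem`), so the
polynomials of shape `rho` lie in the ideal of `lam` (`colPoly_mem_colIdeal`).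

Initial monomials. In a column-increasing tableau the exponent of a letter in the initial monomial
is the sum of the row indices, counted from 0, of the cells containing it. Write a nonzero `f` in
the ideal as `g * x_n ^ d` plus lower powers of `x_n`; then `in(f) = in(g) * x_n ^ d`. A standard
tableau with `l` letters `n` is a standard tableau on the smaller letters plus a horizontal strip of
`l` boxes, and the sum of the row indices of the strip is the exponent of `x_n`. So one needs a
standard tableau dividing `in(g)` whose shape admits a strip of cost at most `d` leading to a shape
dominated by `lam`. These shapes form a lower set for dominance (`stripShapes_isLower`).

The link is evaluation. Fix the first `n - 1` coordinates `a` and let the last one vary. If the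
partition of multiplicities of `a` is not in that lower set, all generators restricted to this line
either vanish or share a divisor of degree greater than `d`; hence `f` vanishes on the line and
`g(a) = 0` (`leadingCoeff_vanishes_of_mem_colIdeal`). It remains to treat polynomials vanishing at
all points with type outside a lower set. This is an induction on the number of variables by the
same recipe with strips of one box, where counting roots replaces the common divisor
(`leadingCoeff_vanishes`, `hasStdDivisor_of_vanishes`). -/

/-- `h` is the sequence of column lengths of a partition of `N` with at most `B` columns. -/
def IsShape (B N : ℕ) (h : ℕ → ℕ) : Prop :=
  Antitone h ∧ (∀ j, B ≤ j → h j = 0) ∧ ∑ j ∈ range B, h j = N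

/-- The dominance order in terms of column lengths: the partition with column lengths `h` is
dominated by the one with column lengths `g`. -/
def ColDominated (h g : ℕ → ℕ) : Prop :=
  ∀ k, ∑ j ∈ range k, g j ≤ ∑ j ∈ range k, h j

/-- A set of shapes that is closed downwards in the dominance order. -/
structure IsLowerShapes (B N : ℕ) (F : Set (ℕ → ℕ)) : Prop where
  isShape : ∀ h ∈ F, IsShape B N h
  mem_of_dominated : ∀ g ∈ F, ∀ h, IsShape B N h → ColDominated h g → h ∈ F

theorem IsShape.sum_range_of_le {B N k : ℕ} {h : ℕ → ℕ} (hh : IsShape B N h) (hk : B ≤ k) :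
    ∑ j ∈ range k, h j = N := by
  rw [← hh.2.2]
  symm
  apply sum_subset (range_mono hk)
  intro j _ hj
  exact hh.2.1 j (by simpa using hj)

theorem IsShape.lt_of_pos {B N j : ℕ} {h : ℕ → ℕ} (hh : IsShape B N h) (hj : 0 < h j) : j < B := by
  by_contra hc
  have := hh.2.1 j (by omega)
  omega

/-- Moving one box from the bottom of column `p` to the bottom of column `q`. -/
def IsBoxMove (p q : ℕ) (h h' : ℕ → ℕ) : Prop :=
  ∀ j, h j + (if j = q then 1 else 0) = h' j + (if j = p then 1 else 0)

theorem IsBoxMove.sum_range {p q : ℕ} {h h' : ℕ → ℕ} (hm : IsBoxMove p q h h') (k : ℕ) :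
    ∑ j ∈ range k, h j + (if q < k then 1 else 0) =
      ∑ j ∈ range k, h' j + (if p < k then 1 else 0) := by
  have := sum_congr (rfl : range k = range k) (fun j _ => hm j)
  simpa [sum_add_distrib, sum_ite_eq'] using this

/-- One step upwards in the dominance order. -/
theorem exists_boxMove {B N : ℕ} {h g : ℕ → ℕ} (hh : IsShape B N h) (hg : IsShape B N g)
    (hd : ColDominated h g) (hne : h ≠ g) :
    ∃ p q h', p < q ∧ q < B ∧ h q + 2 ≤ h p ∧ IsBoxMove p q h h' ∧ IsShape B N h' ∧
      ColDominated h' g := by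
  classical
  have hex : ∃ j, h j ≠ g j := by
    by_contra! hc
    exact hne (funext hc)
  -- `k₀` is the first column where `h` and `g` differ, `p` the end of the plateau of `h` through
  -- `k₀`, and `q` the first later column with `h q < g q`. For `k₀ < k ≤ q` the partial sums of `h`
  -- are strictly larger, which leaves room for the move.
  obtain ⟨k₀, hk₀, hk₀'⟩ : ∃ k₀, h k₀ ≠ g k₀ ∧ ∀ j < k₀, h j = g j :=
    ⟨Nat.find hex, Nat.find_spec hex, fun j hj => by simpa using Nat.find_min hex hj⟩
  have hsum₀ : ∑ j ∈ range k₀, h j = ∑ j ∈ range k₀, g j :=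
    sum_congr rfl fun j hj => hk₀' j (by simpa using hj)
  have hgt : g k₀ < h k₀ := by
    have := hd (k₀ + 1)
    rw [sum_range_succ, sum_range_succ] at this
    omega
  have hex' : ∃ j, h j < h k₀ := ⟨B, by rw [hh.2.1 B le_rfl]; omega⟩
  obtain ⟨p', hp', hpmin⟩ : ∃ p', h p' < h k₀ ∧ ∀ j < p', h k₀ ≤ h j :=
    ⟨Nat.find hex', Nat.find_spec hex', fun j hj => by simpa using Nat.find_min hex' hj⟩
  have hk₀p' : k₀ < p' := by
    by_contra hc
    have := hh.1 (not_lt.1 hc)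
    omega
  obtain ⟨p, rfl⟩ : ∃ p, p' = p + 1 := ⟨p' - 1, by omega⟩
  have hval : ∀ j, k₀ ≤ j → j ≤ p → h j = h k₀ := fun j h1 h2 =>
    le_antisymm (hh.1 h1) (hpmin j (by omega))
  have hlt1 : ∀ k, k₀ < k → k ≤ p + 1 → ∑ j ∈ range k, g j < ∑ j ∈ range k, h j := by
    intro k hk
    induction k, hk using Nat.le_induction with
    | base => intro _; rw [sum_range_succ, sum_range_succ]; omega
    | succ k hk ih =>
      intro hkp
      have h1 := ih (by omega)
      have h2 := hval k (by omega) (by omega)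
      have h3 := hg.1 (show k₀ ≤ k by omega)
      rw [sum_range_succ, sum_range_succ]
      omega
  have hpB : p < B := hh.lt_of_pos (by rw [hval p (by omega) le_rfl]; omega)
  have hexq : ∃ q, p < q ∧ h q < g q := by
    by_contra! hc
    have : ∀ k, p + 1 ≤ k → ∑ j ∈ range k, g j < ∑ j ∈ range k, h j := by
      intro k hk
      induction k, hk using Nat.le_induction with
      | base => exact hlt1 _ hk₀p' le_rfl
      | succ k hk ih =>
        have h2 := hc k (by omega)
        rw [sum_range_succ, sum_range_succ]
        omega
    have := this B hpB
    rw [hh.2.2, hg.2.2] at this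
    omega
  obtain ⟨q, ⟨hpq, hq⟩, hqmin⟩ : ∃ q, (p < q ∧ h q < g q) ∧ ∀ j < q, p < j → g j ≤ h j :=
    ⟨Nat.find hexq, Nat.find_spec hexq, fun j hj hpj => by
      simpa [hpj] using Nat.find_min hexq hj⟩
  have hlt2 : ∀ k, p + 1 ≤ k → k ≤ q → ∑ j ∈ range k, g j < ∑ j ∈ range k, h j := by
    intro k hk
    induction k, hk using Nat.le_induction with
    | base => intro _; exact hlt1 _ hk₀p' le_rfl
    | succ k hk ih =>
      intro hkq
      have h1 := ih (by omega)
      have h2 := hqmin k (by omega) (by omega)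
      rw [sum_range_succ, sum_range_succ]
      omega
  have hqB : q < B := hg.lt_of_pos (by omega)
  have hp0 : h p = h k₀ := hval p (by omega) le_rfl
  -- `h q < g q ≤ g k₀ < h k₀ = h p`.
  have hgap : h q + 2 ≤ h p := by
    have h1 := hg.1 (show k₀ ≤ q by omega)
    omega
  obtain ⟨h', hh'⟩ : ∃ h' : ℕ → ℕ,
      ∀ j, h' j = if j = p then h p - 1 else if j = q then h q + 1 else h j := ⟨_, fun _ => rfl⟩
  have hmove : IsBoxMove p q h h' := by
    intro j
    rw [hh']
    by_cases h1 : j = p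
    · subst h1
      have : j ≠ q := by omega
      simp [this]
      omega
    · by_cases h2 : j = q
      · subst h2
        simp [h1]
      · simp [h1, h2]
  refine ⟨p, q, h', hpq, hqB, hgap, hmove, ⟨?_, ?_, ?_⟩, ?_⟩
  · apply antitone_nat_of_succ_le
    intro j
    have h1 := hh.1 (Nat.le_succ j)
    rw [hh', hh']
    by_cases hjp : j = p
    · subst hjp
      have : j + 1 ≠ j := by omega
      simp only [this, if_false, if_true]
      split_ifs with h2
      · omega
      · omega
    · by_cases hjq : j + 1 = q
      · have h2 := hqmin j (by omega) (by omega)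
        have h3 := hg.1 (show j ≤ q by omega)
        have h5 : j ≠ q := by omega
        simp only [h5, hjp, hjq, if_false, if_true]
        have : q ≠ p := by omega
        simp only [this, if_false]
        omega
      · simp only [hjp, hjq, if_false]
        split_ifs <;> simp_all <;> omega
  · intro j hj
    have h1 : j ≠ p := by omega
    have h2 : j ≠ q := by omega
    simp [hh', h1, h2, hh.2.1 j hj]
  · have := hmove.sum_range B
    rw [hh.2.2, if_pos hqB, if_pos hpB] at this
    omega
  · intro k
    have h1 := hmove.sum_range k
    have h2 := hd k
    have h3 := hlt2 k
    by_cases hpk : p < k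
    · by_cases hqk : q < k
      · rw [if_pos hpk, if_pos hqk] at h1
        omega
      · rw [if_pos hpk, if_neg hqk] at h1
        have := h3 (by omega) (by omega)
        omega
    · rw [if_neg hpk, if_neg (by omega)] at h1
      omega

/-- Induction along the dominance order, by moving one box at a time. -/
theorem dominance_induction {B N : ℕ} {g : ℕ → ℕ} (hg : IsShape B N g) {P : (ℕ → ℕ) → Prop}
    (base : P g)
    (step : ∀ h h' p q, IsShape B N h → IsShape B N h' → p < q → q < B → h q + 2 ≤ h p →
      IsBoxMove p q h h' → P h' → P h) :
    ∀ h, IsShape B N h → ColDominated h g → P h := by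
  -- The sum of all partial sums is the induction measure: moving a box to the right lowers it.
  suffices H : ∀ M h, ∑ k ∈ range (B + 1), ∑ j ∈ range k, h j ≤ M → IsShape B N h →
      ColDominated h g → P h from fun h => H _ h le_rfl
  intro M
  induction M with
  | zero =>
    intro h hM hh hd
    by_cases hne : h = g
    · exact hne ▸ base
    obtain ⟨p, q, h', hpq, hqB, hgap, hm, -, -⟩ := exists_boxMove hh hg hd hne
    have h1 : ∑ j ∈ range (p + 1), h j ≤ ∑ k ∈ range (B + 1), ∑ j ∈ range k, h j :=
      single_le_sum (f := fun k => ∑ j ∈ range k, h j) (fun _ _ => Nat.zero_le _)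
        (by simp; omega)
    rw [sum_range_succ] at h1
    omega
  | succ M ih =>
    intro h hM hh hd
    by_cases hne : h = g
    · exact hne ▸ base
    obtain ⟨p, q, h', hpq, hqB, hgap, hm, hh', hd'⟩ := exists_boxMove hh hg hd hne
    refine step h h' p q hh hh' hpq hqB hgap hm (ih h' ?_ hh' hd')
    have : ∑ k ∈ range (B + 1), ∑ j ∈ range k, h' j <
        ∑ k ∈ range (B + 1), ∑ j ∈ range k, h j := by
      apply sum_lt_sum
      · intro k _
        have := hm.sum_range k
        split_ifs at this <;> omega
      · refine ⟨p + 1, by simp; omega, ?_⟩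
        have := hm.sum_range (p + 1)
        rw [if_neg (by omega), if_pos (by omega)] at this
        omega
    omega

/-- The shapes to which a horizontal strip of `l` boxes, one at the bottom of each of the columns
in a set `S`, can be added with row indices of sum at most `d`, so that the result is dominated by
a member of `F`. -/
def stripShapes (B N l d : ℕ) (F : Set (ℕ → ℕ)) : Set (ℕ → ℕ) :=
  {h | IsShape B N h ∧ ∃ g ∈ F, ∃ S ⊆ range B, S.card = l ∧ ∑ j ∈ S, h j ≤ d ∧
    ∀ k, ∑ j ∈ range k, g j ≤ ∑ j ∈ range k, h j + (S.filter (· < k)).card}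

/-- It suffices to undo one box move. If the strip uses `p` but not `q`, use `q` instead: the gap `h
q + 2 ≤ h p` pays for the change, and the partial sums are those of the old shape with its old
strip. Otherwise the same strip works. -/
theorem stripShapes_isLower (B N l d : ℕ) (F : Set (ℕ → ℕ)) :
    IsLowerShapes B N (stripShapes B N l d F) := by
  refine ⟨fun h hh => hh.1, ?_⟩
  intro g hgF h hh hd
  refine dominance_induction hgF.1 (P := (· ∈ stripShapes B N l d F)) hgF ?_ h hh hd
  rintro h h' p q hh hh' hpq hqB hgap hm ⟨-, g, hg, S, hSB, hSl, hSd, hS⟩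
  have hcost : ∑ j ∈ S, h j + (if q ∈ S then 1 else 0) =
      ∑ j ∈ S, h' j + (if p ∈ S then 1 else 0) := by
    have := sum_congr (rfl : S = S) (fun j _ => hm j)
    simpa [sum_add_distrib, sum_ite_eq'] using this
  by_cases hc : p ∈ S ∧ q ∉ S
  · obtain ⟨hp, hq⟩ := hc
    have hq' : q ∉ S.erase p := fun h => hq (mem_of_mem_erase h)
    refine ⟨hh, g, hg, insert q (S.erase p), ?_, ?_, ?_, ?_⟩
    · intro j hj
      rcases mem_insert.1 hj with rfl | hj
      · simpa using hqB
      · exact hSB (mem_of_mem_erase hj)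
    · rw [card_insert_of_notMem hq', card_erase_of_mem hp, ← hSl]
      have := card_pos.2 ⟨p, hp⟩
      omega
    · rw [sum_insert hq']
      have := add_sum_erase S h hp
      rw [if_neg hq, if_pos hp] at hcost
      omega
    · intro k
      have h1 := hS k
      have h2 := hm.sum_range k
      have h3 : ((insert q (S.erase p)).filter (· < k)).card + (if p < k then 1 else 0) =
          (S.filter (· < k)).card + (if q < k then 1 else 0) := by
        rw [filter_insert, filter_erase]
        have h4 : q ∉ (S.filter (· < k)).erase p := fun h => by simp_all
        by_cases hqk : q < k
        · have hpk : p < k := by omega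
          have h5 : p ∈ S.filter (· < k) := by simp [hp, hpk]
          rw [if_pos hqk, if_pos hqk, if_pos hpk, card_insert_of_notMem h4, card_erase_of_mem h5]
          have := card_pos.2 ⟨p, h5⟩
          omega
        · rw [if_neg hqk, if_neg hqk]
          by_cases hpk : p < k
          · have h5 : p ∈ S.filter (· < k) := by simp [hp, hpk]
            rw [if_pos hpk, card_erase_of_mem h5]
            have := card_pos.2 ⟨p, h5⟩
            omega
          · rw [if_neg hpk, erase_eq_of_notMem (by simp [hpk])]
      omega
  · refine ⟨hh, g, hg, S, hSB, hSl, ?_, ?_⟩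
    · by_cases hp : p ∈ S
      · have hq : q ∈ S := by tauto
        rw [if_pos hp, if_pos hq] at hcost
        omega
      · rw [if_neg hp] at hcost
        omega
    · intro k
      have h1 := hS k
      have h2 := hm.sum_range k
      split_ifs at h2 <;> omega

/-- The set of columns of a horizontal strip can be chosen so that adding the strip gives a
shape. -/
theorem exists_strip {B N l d : ℕ} {F : Set (ℕ → ℕ)} (hF : IsLowerShapes B (N + l) F)
    {h : ℕ → ℕ} (hh : h ∈ stripShapes B N l d F) :
    ∃ S ⊆ range B, S.card = l ∧ ∑ j ∈ S, h j ≤ d ∧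
      (fun j => h j + if j ∈ S then 1 else 0) ∈ F := by
  classical
  obtain ⟨hh, g, hg, S₀, hS₀⟩ := hh
  -- Among admissible strips take one with least sum of column indices. If the result were not a
  -- shape, there would be equal columns `j` and `j + 1` with only `j + 1` in `S`; replacing `j + 1`
  -- by `j` keeps the cost and does not lower the partial sums, contradicting minimality.
  obtain ⟨S, hSmem, hmin⟩ := exists_min_image
    ((range B).powerset.filter fun S => S.card = l ∧ ∑ j ∈ S, h j ≤ d ∧
      ∀ k, ∑ j ∈ range k, g j ≤ ∑ j ∈ range k, h j + (S.filter (· < k)).card)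
    (fun S => ∑ j ∈ S, j) ⟨S₀, by simpa using hS₀⟩
  simp only [mem_filter, mem_powerset] at hSmem hmin
  obtain ⟨hSB, hSl, hSd, hS⟩ := hSmem
  refine ⟨S, hSB, hSl, hSd, hF.mem_of_dominated g hg _ ⟨?_, ?_, ?_⟩ ?_⟩
  · apply antitone_nat_of_succ_le
    intro j
    by_contra hc
    have h1 : h (j + 1) ≤ h j := hh.1 (Nat.le_succ j)
    have hj : j ∉ S := fun hj => by
      rw [if_pos hj] at hc
      split_ifs at hc
      all_goals omega
    have hj1 : j + 1 ∈ S := by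
      by_contra hj1
      rw [if_neg hj1] at hc
      omega
    rw [if_pos hj1, if_neg hj] at hc
    have hjj : h (j + 1) = h j := by omega
    have hj' : j ∉ S.erase (j + 1) := fun h => hj (mem_of_mem_erase h)
    have hlt := hmin (insert j (S.erase (j + 1))) ⟨?_, ?_, ?_, ?_⟩
    · rw [sum_insert hj'] at hlt
      have : j + 1 + ∑ i ∈ S.erase (j + 1), i = ∑ i ∈ S, i := add_sum_erase S (fun j => j) hj1
      omega
    · intro i hi
      rcases mem_insert.1 hi with rfl | hi
      · have := hSB hj1
        simp only [mem_range] at this ⊢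
        omega
      · exact hSB (mem_of_mem_erase hi)
    · rw [card_insert_of_notMem hj', card_erase_of_mem hj1, ← hSl]
      have := card_pos.2 ⟨_, hj1⟩
      omega
    · rw [sum_insert hj']
      have := add_sum_erase S h hj1
      omega
    · intro k
      refine (hS k).trans ?_
      apply Nat.add_le_add_left
      rw [filter_insert, filter_erase]
      by_cases hk : j < k
      · rw [if_pos hk, card_insert_of_notMem (fun h => hj' (by simp_all))]
        have := pred_card_le_card_erase (s := S.filter (· < k)) (a := j + 1)
        omega
      · rw [if_neg hk, erase_eq_of_notMem (by simp; omega)]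
  · intro j hj
    have : j ∉ S := fun h => by have := hSB h; simp at this; omega
    simp [this, hh.2.1 j hj]
  · rw [sum_add_distrib, hh.2.2, sum_ite_mem, sum_const, inter_eq_right.2 hSB, hSl]
    simp
  · intro k
    refine (hS k).trans ?_
    rw [sum_add_distrib, sum_ite_mem, sum_const]
    simp only [smul_eq_mul, mul_one]
    apply Nat.add_le_add_left
    apply card_le_card
    intro i
    simp
    tauto

end SpechtIdeals

/-! ### Multiplicity types of points and the cheapest strip -/

namespace SpechtIdeals

open Finset

section PointType

variable {K : Type*} [DecidableEq K]

/-- The number of coordinates of `a` that are equal to `v`. -/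
def valueMult {n : ℕ} (a : Fin n → K) (v : K) : ℕ :=
  (univ.filter fun i => a i = v).card

/-- The column lengths of the partition given by the multiplicities of the coordinates of `a`. -/
def pointType {n : ℕ} (a : Fin n → K) (j : ℕ) : ℕ :=
  ((univ.image a).filter fun v => j < valueMult a v).card

theorem valueMult_le {n : ℕ} (a : Fin n → K) (v : K) : valueMult a v ≤ n :=
  (card_le_univ _).trans (by simp)

theorem valueMult_pos_iff {n : ℕ} {a : Fin n → K} {v : K} :
    0 < valueMult a v ↔ v ∈ univ.image a := by
  simp [valueMult, card_pos, Finset.Nonempty]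

theorem pointType_eq_of_subset {n : ℕ} {a : Fin n → K} {V : Finset K} (hV : univ.image a ⊆ V)
    (j : ℕ) : pointType a j = (V.filter fun v => j < valueMult a v).card := by
  unfold pointType
  congr 1
  ext v
  simp only [mem_filter]
  refine ⟨fun h => ⟨hV h.1, h.2⟩, fun h => ⟨valueMult_pos_iff.1 (by omega), h.2⟩⟩

theorem sum_pointType {n : ℕ} (a : Fin n → K) (S : Finset ℕ) :
    ∑ j ∈ S, pointType a j = ∑ v ∈ univ.image a, (S.filter (· < valueMult a v)).card := by
  simp only [pointType, card_filter]
  exact sum_comm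

theorem sum_range_pointType {n : ℕ} (a : Fin n → K) (k : ℕ) :
    ∑ j ∈ range k, pointType a j = ∑ v ∈ univ.image a, min k (valueMult a v) := by
  rw [sum_pointType]
  refine sum_congr rfl fun v _ => ?_
  rw [show (range k).filter (· < valueMult a v) = range (min k (valueMult a v)) by
    ext; simp, card_range]

theorem isShape_pointType {n B : ℕ} (hn : n ≤ B) (a : Fin n → K) :
    IsShape B n (pointType a) := by
  refine ⟨?_, ?_, ?_⟩
  · intro i j hij
    refine card_le_card fun v => ?_
    simp only [mem_filter]
    exact fun h => ⟨h.1, by omega⟩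
  · intro j hj
    rw [pointType, card_eq_zero, filter_eq_empty_iff]
    intro v _
    have := valueMult_le a v
    omega
  · rw [sum_range_pointType]
    conv_rhs => rw [← Fintype.card_fin n, ← card_univ,
      card_eq_sum_card_image a univ]
    refine sum_congr rfl fun v _ => ?_
    have := valueMult_le a v
    rw [min_eq_right (by omega)]
    rfl

theorem valueMult_snoc {n : ℕ} (a : Fin n → K) (c v : K) :
    valueMult (Fin.snoc a c : Fin (n + 1) → K) v = valueMult a v + if v = c then 1 else 0 := by
  simp only [valueMult, card_filter, Fin.sum_univ_castSucc, Fin.snoc_castSucc, Fin.snoc_last]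
  simp [eq_comm]

/-- One more occurrence of `c` passes exactly one threshold, so the new box lands in the column
whose index (from 0) is the old multiplicity of `c`. -/
theorem pointType_snoc {n : ℕ} (a : Fin n → K) (c : K) (j : ℕ) :
    pointType (Fin.snoc a c : Fin (n + 1) → K) j =
      pointType a j + if j = valueMult a c then 1 else 0 := by
  have h1 : univ.image (Fin.snoc a c : Fin (n + 1) → K) ⊆ insert c (univ.image a) := by
    intro v
    simp only [mem_image, mem_univ, true_and, mem_insert]
    rintro ⟨i, rfl⟩
    induction i using Fin.lastCases with
    | last => simp
    | cast i => simp
  rw [pointType_eq_of_subset h1, pointType_eq_of_subset (subset_insert c (univ.image a)),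
    card_filter, card_filter]
  have h2 : (if j = valueMult a c then 1 else 0) =
      ∑ v ∈ insert c (univ.image a), if v = c then (if j = valueMult a c then 1 else 0) else 0 := by
    rw [sum_ite_eq' (insert c (univ.image a)) c, if_pos (mem_insert_self _ _)]
  rw [h2, ← sum_add_distrib]
  refine sum_congr rfl fun v _ => ?_
  rw [valueMult_snoc]
  by_cases hv : v = c
  · subst hv
    simp only [if_true]
    split_ifs <;> omega
  · simp [hv]

/-- Let `k` be the first column of length at most `d`. Column `k - 1` counts more than `d` values,
all of multiplicity at least `k`, and every one of them qualifies. -/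
theorem card_filter_pointType_le {n d : ℕ} {a : Fin n → K} (hd : d < pointType a 0) :
    d < ((univ.image a).filter fun v => pointType a (valueMult a v) ≤ d).card := by
  classical
  have hsh := isShape_pointType le_rfl a
  have hex : ∃ k, pointType a k ≤ d := ⟨n, by rw [hsh.2.1 n le_rfl]; omega⟩
  obtain ⟨k, hk, hmin⟩ : ∃ k, pointType a k ≤ d ∧ ∀ j < k, d < pointType a j :=
    ⟨Nat.find hex, Nat.find_spec hex, fun j hj => by simpa using Nat.find_min hex hj⟩
  have hk0 : k ≠ 0 := by rintro rfl; omega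
  refine (hmin (k - 1) (by omega)).trans_le (card_le_card fun v => ?_)
  simp only [mem_filter]
  exact fun h => ⟨h.1, (hsh.1 (by omega)).trans hk⟩

/-- For disjoint columns `D j`, the number of columns among the first `k` in which the value `u`
occurs. -/
theorem card_filter_mem_image_le {n : ℕ} {a : Fin n → K} {D : ℕ → Finset (Fin n)}
    (hdisj : ∀ i j j', i ∈ D j → i ∈ D j' → j = j') (k : ℕ) (u : K) :
    ((range k).filter fun j => u ∈ (D j).image a).card ≤ min k (valueMult a u) := by
  refine le_min ((card_filter_le _ _).trans (by simp)) ?_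
  rcases isEmpty_or_nonempty (Fin n) with hn | hn
  · rw [card_eq_zero.2]
    · exact Nat.zero_le _
    · rw [filter_eq_empty_iff]
      intro j _ h
      obtain ⟨i, -⟩ := mem_image.1 h
      exact hn.elim i
  choose! r hr using fun j (hj : u ∈ (D j).image a) => mem_image.1 hj
  refine card_le_card_of_injOn r ?_ ?_
  · intro j hj
    simp only [coe_filter, Set.mem_ofPred_eq] at hj
    simpa using (hr j hj.2).2
  · intro j hj j' hj' he
    simp only [coe_filter, Set.mem_ofPred_eq] at hj hj'
    exact hdisj (r j) _ _ (hr j hj.2).1 (he ▸ (hr j' hj'.2).1)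

theorem sum_card_eq_sum_image {n : ℕ} {a : Fin n → K} {D : ℕ → Finset (Fin n)}
    (hinj : ∀ j, Set.InjOn a (D j)) (k : ℕ) :
    ∑ j ∈ range k, (D j).card =
      ∑ u ∈ univ.image a, ((range k).filter fun j => u ∈ (D j).image a).card := by
  simp only [card_filter]
  rw [sum_comm]
  refine sum_congr rfl fun j _ => ?_
  rw [← card_filter, ← card_image_of_injOn (hinj j)]
  congr 1
  ext u
  simp only [mem_filter]
  exact ⟨fun h => ⟨image_subset_image (subset_univ _) h, h⟩, fun h => h.2⟩

theorem sum_card_le_sum_pointType {n : ℕ} {a : Fin n → K} {D : ℕ → Finset (Fin n)}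
    (hinj : ∀ j, Set.InjOn a (D j)) (hdisj : ∀ i j j', i ∈ D j → i ∈ D j' → j = j') (k : ℕ) :
    ∑ j ∈ range k, (D j).card ≤ ∑ j ∈ range k, pointType a j := by
  rw [sum_card_eq_sum_image hinj, sum_range_pointType]
  exact sum_le_sum fun u _ => card_filter_mem_image_le hdisj k u

/-- Count value by value. A value `u ≠ v` occurs in at most `min k (valueMult a u)` of the first `k`
columns. For `v`, the columns containing it and those in `L` have a union of size at most `k`, and
their intersection is bounded by the last term. -/
theorem sum_card_add_le {n : ℕ} {a : Fin n → K} {D : ℕ → Finset (Fin n)}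
    (hinj : ∀ j, Set.InjOn a (D j)) (hdisj : ∀ i j j', i ∈ D j → i ∈ D j' → j = j')
    (L : Finset ℕ) {v : K} (hv : v ∈ univ.image a) (k : ℕ) :
    ∑ j ∈ range k, (D j).card + (L.filter (· < k)).card ≤
      ∑ j ∈ range k, pointType a j + (k - valueMult a v) +
        (L.filter fun j => v ∈ (D j).image a).card := by
  rw [sum_card_eq_sum_image hinj, sum_range_pointType, ← add_sum_erase _ _ hv,
    ← add_sum_erase (univ.image a) (fun v => min k (valueMult a v)) hv]
  have h1 := sum_le_sum fun u (_ : u ∈ (univ.image a).erase v) =>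
    card_filter_mem_image_le (a := a) hdisj k u
  have h2 := card_union_add_card_inter ((range k).filter fun j => v ∈ (D j).image a)
    (L.filter (· < k))
  have h3 : (((range k).filter fun j => v ∈ (D j).image a) ∪ L.filter (· < k)).card ≤ k := by
    conv_rhs => rw [← card_range k]
    apply card_le_card
    intro j
    simp only [mem_union, mem_filter, mem_range]
    tauto
  have h4 : (((range k).filter fun j => v ∈ (D j).image a) ∩ L.filter (· < k)).card ≤
      (L.filter fun j => v ∈ (D j).image a).card := by
    apply card_le_card
    intro j
    simp only [mem_inter, mem_filter]
    tauto
  omega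

end PointType

/-- The cheapest horizontal strip: among the strips whose addition to `h` gives something
dominated by `g`, there is one with pointwise minimal counting function. -/
theorem exists_minimal_strip {B N l : ℕ} {h g : ℕ → ℕ} (hh : IsShape B N h)
    (hg : IsShape B (N + l) g)
    (h1 : ∀ k, ∑ j ∈ range k, g j ≤ ∑ j ∈ range k, h j + k)
    (h2 : ∀ k, ∑ j ∈ range k, g j ≤ ∑ j ∈ range k, h j + l) :
    ∃ S ⊆ range B, S.card = l ∧
      (∀ k, ∑ j ∈ range k, g j ≤ ∑ j ∈ range k, h j + (S.filter (· < k)).card) ∧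
      ∀ k t, (∀ k', ∑ j ∈ range k', g j ≤ ∑ j ∈ range k', h j + (k' - k) + t) →
        (S.filter (· < k)).card ≤ t := by
  -- `M` is the least counting function that majorizes the deficit of `h` against `g` and grows by 0
  -- or 1 at each step; the strip consists of the columns at which `M` jumps. Truncated subtraction
  -- makes the penalty `k' - k` vanish for `k' ≤ k`.
  obtain ⟨M, hM⟩ : ∃ M : ℕ → ℕ, ∀ k, M k = (range (B + 1)).sup
      fun k' => ∑ j ∈ range k', g j - ∑ j ∈ range k', h j - (k' - k) := ⟨_, fun _ => rfl⟩
  have hM0 : M 0 = 0 := by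
    rw [hM, ← Nat.le_zero, Finset.sup_le_iff]
    intro k' _
    have := h1 k'
    omega
  have hmono : ∀ k, M k ≤ M (k + 1) := by
    intro k
    rw [hM, hM]
    refine sup_mono_fun fun k' _ => ?_
    omega
  have hstep : ∀ k, M (k + 1) ≤ M k + 1 := by
    intro k
    rw [hM (k + 1), Finset.sup_le_iff]
    intro k' hk'
    have := le_sup (f := fun k' => ∑ j ∈ range k', g j - ∑ j ∈ range k', h j - (k' - k)) hk'
    rw [← hM] at this
    omega
  have hMt : ∀ k t, (∀ k', ∑ j ∈ range k', g j ≤ ∑ j ∈ range k', h j + (k' - k) + t) →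
      M k ≤ t := by
    intro k t ht
    rw [hM, Finset.sup_le_iff]
    intro k' _
    have := ht k'
    omega
  have hMge : ∀ k ≤ B, ∑ j ∈ range k, g j ≤ ∑ j ∈ range k, h j + M k := by
    intro k hk
    have := le_sup (f := fun k' => ∑ j ∈ range k', g j - ∑ j ∈ range k', h j - (k' - k))
      (show k ∈ range (B + 1) by simp; omega)
    rw [← hM] at this
    omega
  have hMB : M B = l := by
    apply le_antisymm
    · apply hMt
      intro k
      have := h2 k
      omega
    · have := hMge B le_rfl
      rw [hh.2.2, hg.2.2] at this
      omega
  have hcard : ∀ k ≤ B, (((range B).filter fun k => M k < M (k + 1)).filter (· < k)).card = M k := by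
    intro k
    induction k with
    | zero => intro _; simp [hM0]
    | succ k ih =>
      intro hk
      have h3 := hmono k
      have h4 := hstep k
      by_cases hlt : M k < M (k + 1)
      · have : (((range B).filter fun k => M k < M (k + 1)).filter (· < k + 1)) =
            insert k (((range B).filter fun k => M k < M (k + 1)).filter (· < k)) := by
          ext j
          simp only [mem_filter, mem_insert, mem_range]
          by_cases hj : j = k
          · subst hj
            simp [hlt]
            omega
          · simp only [hj, false_or]
            exact and_congr_right fun _ => by omega
        rw [this, card_insert_of_notMem (by simp), ih (by omega)]
        omega
      · rw [show M (k + 1) = M k by omega, ← ih (by omega)]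
        congr 1
        ext j
        simp only [mem_filter, mem_range]
        refine ⟨fun h => ⟨h.1, ?_⟩, fun h => ⟨h.1, by omega⟩⟩
        have : j ≠ k := by rintro rfl; exact hlt h.1.2
        omega
  have hall : ∀ k, B ≤ k → ((range B).filter fun k => M k < M (k + 1)).filter (· < k) =
      ((range B).filter fun k => M k < M (k + 1)) := by
    intro k hk
    rw [filter_eq_self]
    intro j hj
    simp only [mem_filter, mem_range] at hj
    omega
  have hcardS : ((range B).filter fun k => M k < M (k + 1)).card = l := by
    rw [← hall B le_rfl, hcard B le_rfl, hMB]
  refine ⟨_, filter_subset _ _, hcardS, ?_, ?_⟩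
  · intro k
    rcases le_total k B with hk | hk
    · rw [hcard k hk]
      exact hMge k hk
    · rw [hall k hk, hcardS, hh.sum_range_of_le hk, hg.sum_range_of_le hk]
  · intro k t ht
    rcases le_total k B with hk | hk
    · rw [hcard k hk]
      exact hMt k t ht
    · rw [hall k hk, hcardS, ← hMB]
      apply hMt
      intro k'
      have h3 := ht k'
      rcases le_total k' B with hk' | hk'
      · omega
      · rw [hh.sum_range_of_le hk', hg.sum_range_of_le hk'] at h3 ⊢
        have h4 := ht B
        rw [hh.2.2, hg.2.2] at h4
        omega

end SpechtIdeals

/-! ### Splitting off the last variable -/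

namespace SpechtIdeals

open MvPolynomial

section LastVariable

variable {K : Type*} [Field K] {m : ℕ}

/-- A polynomial in `m + 1` variables as a polynomial in the last variable. -/
noncomputable def toPolyLast (K : Type*) [Field K] (m : ℕ) :
    MvPolynomial (Fin (m + 1)) K →ₐ[K] Polynomial (MvPolynomial (Fin m) K) :=
  aeval (Fin.snoc (fun i => Polynomial.C (X i)) Polynomial.X :
    Fin (m + 1) → Polynomial (MvPolynomial (Fin m) K))

/-- The exponent vector `s` extended by the exponent `d` of the last variable. -/
noncomputable def snocExp (s : Fin m →₀ ℕ) (d : ℕ) : Fin (m + 1) →₀ ℕ :=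
  Finsupp.equivFunOnFinite.symm (Fin.snoc s d : Fin (m + 1) → ℕ)

@[simp]
theorem snocExp_castSucc (s : Fin m →₀ ℕ) (d : ℕ) (i : Fin m) :
    snocExp s d i.castSucc = s i := by
  simp [snocExp]

@[simp]
theorem snocExp_last (s : Fin m →₀ ℕ) (d : ℕ) : snocExp s d (Fin.last m) = d := by
  simp [snocExp]

theorem exists_eq_snocExp (t : Fin (m + 1) →₀ ℕ) : ∃ s d, t = snocExp s d := by
  refine ⟨Finsupp.equivFunOnFinite.symm fun i => t i.castSucc, t (Fin.last m), ?_⟩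
  ext i
  induction i using Fin.lastCases with
  | last => simp
  | cast i => simp

theorem snocExp_inj {s s' : Fin m →₀ ℕ} {d d' : ℕ} :
    snocExp s d = snocExp s' d' ↔ s = s' ∧ d = d' := by
  refine ⟨fun h => ⟨?_, ?_⟩, by rintro ⟨rfl, rfl⟩; rfl⟩
  · ext i
    simpa using DFunLike.congr_fun h i.castSucc
  · simpa using DFunLike.congr_fun h (Fin.last m)

theorem toPolyLast_monomial (s : Fin m →₀ ℕ) (d : ℕ) (c : K) :
    toPolyLast K m (monomial (snocExp s d) c) = Polynomial.monomial d (monomial s c) := by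
  rw [toPolyLast, aeval_monomial, Finsupp.prod_fintype _ _ (fun _ => pow_zero _),
    Fin.prod_univ_castSucc]
  simp only [snocExp_castSucc, snocExp_last, Fin.snoc_castSucc, Fin.snoc_last]
  rw [← Polynomial.C_mul_X_pow_eq_monomial, monomial_eq (s := s) (a := c),
    Finsupp.prod_fintype _ _ (fun _ => pow_zero _)]
  simp only [map_mul, map_prod, map_pow]
  rw [← mul_assoc]
  rfl

theorem coeff_toPolyLast (f : MvPolynomial (Fin (m + 1)) K) (s : Fin m →₀ ℕ) (d : ℕ) :
    coeff s ((toPolyLast K m f).coeff d) = coeff (snocExp s d) f := by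
  classical
  induction f using MvPolynomial.induction_on' with
  | monomial t c =>
    obtain ⟨s', d', rfl⟩ := exists_eq_snocExp t
    rw [toPolyLast_monomial, Polynomial.coeff_monomial, coeff_monomial]
    simp only [snocExp_inj]
    by_cases h : d' = d
    · simp [h, coeff_monomial]
    · simp [h]
  | add p q hp hq => simp [hp, hq]

theorem eval_snoc (f : MvPolynomial (Fin (m + 1)) K) (a : Fin m → K) (c : K) :
    eval (Fin.snoc a c : Fin (m + 1) → K) f =
      ((toPolyLast K m f).map (eval a)).eval c := by
  induction f using MvPolynomial.induction_on with
  | C r => simp [toPolyLast, Polynomial.algebraMap_apply, MvPolynomial.algebraMap_eq]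
  | add p q hp hq => simp [hp, hq]
  | mul_X p i hp =>
    rw [map_mul, map_mul, Polynomial.map_mul, Polynomial.eval_mul, hp]
    congr 1
    induction i using Fin.lastCases with
    | last => simp [toPolyLast]
    | cast i => simp [toPolyLast]

theorem toPolyLast_ne_zero {f : MvPolynomial (Fin (m + 1)) K} (hf : f ≠ 0) :
    toPolyLast K m f ≠ 0 := by
  obtain ⟨t, ht⟩ := ne_zero_iff.1 hf
  obtain ⟨s, d, rfl⟩ := exists_eq_snocExp t
  intro h
  apply ht
  rw [← coeff_toPolyLast, h]
  simp

/-- The last variable is the largest, so the lexicographic order first compares its exponent and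
then the remaining ones. -/
theorem degree_eq_snocExp {f : MvPolynomial (Fin (m + 1)) K} (hf : f ≠ 0) :
    (lexOrder (m + 1)).degree f =
      snocExp ((lexOrder m).degree (toPolyLast K m f).leadingCoeff)
        (toPolyLast K m f).natDegree := by
  have hg : (toPolyLast K m f).leadingCoeff ≠ 0 :=
    Polynomial.leadingCoeff_ne_zero.2 (toPolyLast_ne_zero hf)
  apply (lexOrder (m + 1)).toSyn.injective
  apply le_antisymm
  · rw [MonomialOrder.degree_le_iff]
    intro b hb
    obtain ⟨s, d, rfl⟩ := exists_eq_snocExp b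
    rw [mem_support_iff, ← coeff_toPolyLast] at hb
    have hd : d ≤ (toPolyLast K m f).natDegree := by
      apply Polynomial.le_natDegree_of_ne_zero
      intro h
      rw [h] at hb
      simp at hb
    rcases hd.lt_or_eq with hlt | rfl
    · apply le_of_lt
      rw [lexOrder_lt_iff]
      refine ⟨Fin.last m, fun j hj => absurd hj (Fin.le_last j).not_gt, by simpa using hlt⟩
    · have hs := (lexOrder m).le_degree (mem_support_iff.2 hb)
      rw [Polynomial.coeff_natDegree] at hs
      rcases hs.lt_or_eq with hlt | heq
      · apply le_of_lt
        rw [lexOrder_lt_iff] at hlt ⊢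
        obtain ⟨i, hi, hlt⟩ := hlt
        refine ⟨i.castSucc, fun j hj => ?_, by simpa using hlt⟩
        induction j using Fin.lastCases with
        | last => simp
        | cast j => simpa using hi j (by simpa using hj)
      · rw [(lexOrder m).toSyn.injective heq]
  · apply (lexOrder (m + 1)).le_degree
    rw [mem_support_iff, ← coeff_toPolyLast]
    exact mem_support_iff.1 ((lexOrder m).degree_mem_support hg)

end LastVariable

end SpechtIdeals

/-! ### Standard column sets and their exponent vectors -/

namespace SpechtIdeals

open MvPolynomial

section Columns

variable {n : ℕ}

/-- The pairs of distinct letters in a column, the smaller one first. -/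
def colPairs (A : Finset (Fin n)) : Finset (Fin n × Fin n) :=
  (A ×ˢ A).filter fun q => q.1 < q.2

/-- The exponent vector of the initial monomial of the product of the Vandermonde products of the
columns `C 0, …, C (B - 1)`. -/
noncomputable def colExpo (B : ℕ) (C : ℕ → Finset (Fin n)) : Fin n →₀ ℕ :=
  ∑ j ∈ Finset.range B, ∑ q ∈ colPairs (C j), Finsupp.single q.2 1

/-- Columns `C` form a standard tableau: for each `k`, the cells with letters smaller than `k`
form the diagram of a partition. -/
def IsStdCols (C : ℕ → Finset (Fin n)) : Prop :=
  ∀ k : ℕ, Antitone fun j => ((C j).filter fun e : Fin n => (e : ℕ) < k).card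

theorem colExpo_apply (B : ℕ) (C : ℕ → Finset (Fin n)) (e : Fin n) :
    colExpo B C e =
      ∑ j ∈ Finset.range B, if e ∈ C j then ((C j).filter (· < e)).card else 0 := by
  rw [colExpo, Finsupp.finsetSum_apply]
  refine Finset.sum_congr rfl fun j _ => ?_
  rw [Finsupp.finsetSum_apply]
  simp only [Finsupp.single_apply]
  rw [← Finset.card_filter]
  split_ifs with he
  · apply Finset.card_nbij' (fun q => q.1) (fun x => (x, e))
    · intro q hq
      simp only [colPairs, Finset.coe_filter, Finset.mem_filter, Finset.mem_product,
        Set.mem_ofPred_eq] at hq ⊢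
      exact ⟨hq.1.1.1, hq.2 ▸ hq.1.2⟩
    · intro x hx
      simp only [colPairs, Finset.coe_filter, Finset.mem_filter, Finset.mem_product,
        Set.mem_ofPred_eq] at hx ⊢
      exact ⟨⟨⟨hx.1, he⟩, hx.2⟩, trivial⟩
    · intro q hq
      simp only [colPairs, Finset.coe_filter, Finset.mem_filter, Finset.mem_product,
        Set.mem_ofPred_eq] at hq
      exact Prod.ext rfl hq.2.symm
    · intro x _
      rfl
  · rw [Finset.card_eq_zero, Finset.filter_eq_empty_iff]
    intro q hq h
    simp only [colPairs, Finset.mem_filter, Finset.mem_product] at hq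
    exact he (h ▸ hq.1.2)

/-- Adding the letter `n` to the columns in `S`. -/
def extendCols (C : ℕ → Finset (Fin n)) (S : Finset ℕ) (j : ℕ) : Finset (Fin (n + 1)) :=
  (C j).map Fin.castSuccEmb ∪ if j ∈ S then {Fin.last n} else ∅

variable (C : ℕ → Finset (Fin n)) (S : Finset ℕ)

@[simp]
theorem castSucc_mem_extendCols {j : ℕ} {e : Fin n} :
    e.castSucc ∈ extendCols C S j ↔ e ∈ C j := by
  simp only [extendCols, Finset.mem_union, Finset.mem_map, Fin.castSuccEmb_apply]
  split_ifs <;> simp [Fin.castSucc_ne_last]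

@[simp]
theorem last_mem_extendCols {j : ℕ} : Fin.last n ∈ extendCols C S j ↔ j ∈ S := by
  simp only [extendCols, Finset.mem_union, Finset.mem_map, Fin.castSuccEmb_apply]
  split_ifs with h <;> simp [Fin.castSucc_ne_last, h]

theorem card_filter_extendCols (j : ℕ) (p : Fin (n + 1) → Prop) [DecidablePred p] :
    ((extendCols C S j).filter p).card =
      ((C j).filter fun e => p e.castSucc).card + if p (Fin.last n) ∧ j ∈ S then 1 else 0 := by
  have h1 : ((extendCols C S j).filter p) =
      ((C j).filter fun e => p e.castSucc).map Fin.castSuccEmb ∪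
        if p (Fin.last n) ∧ j ∈ S then {Fin.last n} else ∅ := by
    ext e
    induction e using Fin.lastCases with
    | last =>
      simp only [Finset.mem_filter, last_mem_extendCols, Finset.mem_union, Finset.mem_map,
        Fin.castSuccEmb_apply]
      split_ifs with h
      · simp [h]
      · simp [Fin.castSucc_ne_last]
        tauto
    | cast e =>
      simp only [Finset.mem_filter, castSucc_mem_extendCols, Finset.mem_union, Finset.mem_map,
        Fin.castSuccEmb_apply]
      split_ifs with h <;> simp [Fin.castSucc_ne_last]
  rw [h1, Finset.card_union_of_disjoint, Finset.card_map]
  · split_ifs <;> simp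
  · split_ifs <;> simp [Fin.castSucc_ne_last]

theorem card_extendCols (j : ℕ) :
    (extendCols C S j).card = (C j).card + if j ∈ S then 1 else 0 := by
  simpa using card_filter_extendCols C S j fun _ => True

variable {C S}

theorem isStdCols_extendCols (hC : IsStdCols C)
    (hS : Antitone fun j => (C j).card + if j ∈ S then 1 else 0) :
    IsStdCols (extendCols C S) := by
  intro k
  simp only [card_filter_extendCols]
  rcases lt_or_ge n k with hk | hk
  · convert hS using 3 with j
    · rw [Finset.filter_true_of_mem]
      intro e _
      simp only [Fin.val_castSucc]
      omega
    · simp [hk]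
  · convert hC k using 2 with j
    simp
    omega

theorem colExpo_extendCols_castSucc (B : ℕ) (e : Fin n) :
    colExpo B (extendCols C S) e.castSucc = colExpo B C e := by
  rw [colExpo_apply, colExpo_apply]
  refine Finset.sum_congr rfl fun j _ => ?_
  simp [card_filter_extendCols, (Fin.castSucc_lt_last e).not_gt]

theorem colExpo_extendCols_last {B : ℕ} (hS : S ⊆ Finset.range B) :
    colExpo B (extendCols C S) (Fin.last n) = ∑ j ∈ S, (C j).card := by
  rw [colExpo_apply]
  simp [card_filter_extendCols, Fin.castSucc_lt_last]
  congr 1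
  ext j
  simp
  exact fun h => by simpa using hS h

end Columns

/-! ### Polynomials vanishing outside a lower set of types -/

section Vanishing

variable {K : Type*} [Field K]

/-- `f` has an initial monomial that is divisible by the one of a standard tableau with shape in
`F`, in which the letter `e` occurs `w e` times. -/
def HasStdDivisor {n : ℕ} (B : ℕ) (F : Set (ℕ → ℕ)) (w : Fin n → ℕ)
    (f : MvPolynomial (Fin n) K) : Prop :=
  ∃ C : ℕ → Finset (Fin n), IsStdCols C ∧ (fun j => (C j).card) ∈ F ∧
    (∀ e, ((Finset.range B).filter fun j => e ∈ C j).card = w e) ∧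
    ∀ e, colExpo B C e ≤ (lexOrder n).degree f e

/-- The inductive step for both kinds of `f`: put the last letter at the bottom of the columns of a
strip supplied by `exists_strip`. Smaller letters keep their exponents, and the new letter gets the
cost of the strip, at most the degree in the last variable. -/
theorem hasStdDivisor_of_leadingCoeff {m B l : ℕ} {F : Set (ℕ → ℕ)}
    (hF : IsLowerShapes B (m + l) F) {f : MvPolynomial (Fin (m + 1)) K} (hf : f ≠ 0)
    (hg : HasStdDivisor B (stripShapes B m l (toPolyLast K m f).natDegree F) (fun _ => 1)
      (toPolyLast K m f).leadingCoeff) :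
    HasStdDivisor B F (Fin.snoc (fun _ => 1) l : Fin (m + 1) → ℕ) f := by
  obtain ⟨C, hC, hCF, hCc, hCe⟩ := hg
  obtain ⟨S, hSB, hSl, hSd, hSF⟩ := exists_strip hF hCF
  refine ⟨extendCols C S, isStdCols_extendCols hC (hF.isShape _ hSF).1, ?_, ?_, ?_⟩
  · simpa only [card_extendCols] using hSF
  · intro e
    induction e using Fin.lastCases with
    | last =>
      simp only [last_mem_extendCols, Fin.snoc_last]
      rw [Finset.filter_mem_eq_inter, Finset.inter_eq_right.2 hSB, hSl]
    | cast e => simpa using hCc e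
  · intro e
    rw [degree_eq_snocExp hf]
    induction e using Fin.lastCases with
    | last => rwa [colExpo_extendCols_last hSB, snocExp_last]
    | cast e => rw [colExpo_extendCols_castSucc, snocExp_castSucc]; exact hCe e

variable [DecidableEq K]

/-- On the line above `a`, each `c` whose added box would cost at most `d` is a root, since
otherwise that box would be an admissible strip for `a`. There are more than `d` such `c`. -/
theorem leadingCoeff_vanishes {m B : ℕ} [Infinite K] (hm : m + 1 ≤ B) {F : Set (ℕ → ℕ)}
    {f : MvPolynomial (Fin (m + 1)) K} (hv : ∀ a, pointType a ∉ F → eval a f = 0)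
    (a : Fin m → K)
    (ha : pointType a ∉ stripShapes B m 1 (toPolyLast K m f).natDegree F) :
    eval a (toPolyLast K m f).leadingCoeff = 0 := by
  set d := (toPolyLast K m f).natDegree with hd
  have hroot : ∀ c, pointType a (valueMult a c) ≤ d →
      ((toPolyLast K m f).map (eval a)).eval c = 0 := by
    intro c hc
    rw [← eval_snoc]
    apply hv
    intro hF
    refine ha ⟨isShape_pointType (by omega) a, _, hF, {valueMult a c}, ?_, by simp, by simpa, ?_⟩
    · have := valueMult_le a c
      simp
      omega
    · intro k
      simp only [pointType_snoc, Finset.sum_add_distrib, Finset.sum_ite_eq', Finset.mem_range]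
      rw [Finset.filter_singleton]
      split_ifs <;> simp
  have hzero : (toPolyLast K m f).map (eval a) = 0 := by
    -- A value not among the coordinates of `a` adds a box to column 0. If that costs at most `d`,
    -- the infinitely many such values are roots; otherwise the coordinates of `a` already supply
    -- enough roots.
    rcases lt_or_ge d (pointType a 0) with h0 | h0
    · apply Polynomial.eq_zero_of_natDegree_lt_card_of_eval_eq_zero' _
        ((Finset.univ.image a).filter fun v => pointType a (valueMult a v) ≤ d)
      · intro c hc
        exact hroot c (Finset.mem_filter.1 hc).2
      · exact (Polynomial.natDegree_map_le).trans_lt (card_filter_pointType_le h0)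
    · apply Polynomial.eq_zero_of_infinite_isRoot
      refine Set.Infinite.mono ?_ (Finset.univ.image a).finite_toSet.infinite_compl
      intro c hc
      apply hroot
      have : valueMult a c = 0 := by
        by_contra h
        exact hc (valueMult_pos_iff.1 (by omega))
      rwa [this]
  have := congrArg (fun p => p.coeff d) hzero
  simpa [Polynomial.coeff_map, hd] using this

/-- A nonzero polynomial that vanishes at all points with type outside a lower set `F` of shapes
has an initial monomial that is divisible by the one of a standard tableau with shape in `F`. -/
theorem hasStdDivisor_of_vanishes [Infinite K] {B : ℕ} : ∀ {n : ℕ}, n ≤ B →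
    ∀ {F : Set (ℕ → ℕ)}, IsLowerShapes B n F → ∀ {f : MvPolynomial (Fin n) K}, f ≠ 0 →
      (∀ a, pointType a ∉ F → eval a f = 0) → HasStdDivisor B F (fun _ => 1) f := by
  intro n
  induction n with
  | zero =>
    intro _ F hF f hf hv
    refine ⟨fun _ => ∅, fun k => ?_, ?_, fun e => e.elim0, fun e => e.elim0⟩
    · simpa using antitone_const
    · by_contra h
      apply hf
      have h0 := hv (fun e => e.elim0) (fun hm => h (by convert hm using 1; ext j; simp [pointType]))
      obtain ⟨c, rfl⟩ := C_surjective (Fin 0) f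
      simpa using h0
  | succ m ih =>
    intro hm F hF f hf hv
    have := hasStdDivisor_of_leadingCoeff (l := 1) hF hf (ih (by omega)
      (stripShapes_isLower _ _ _ _ _)
      (Polynomial.leadingCoeff_ne_zero.2 (toPolyLast_ne_zero hf))
      (leadingCoeff_vanishes hm hv))
    convert this using 1
    ext e
    induction e using Fin.lastCases <;> simp

end Vanishing

end SpechtIdeals

/-! ### Vandermonde products and the exchange relation -/

namespace SpechtIdeals

open MvPolynomial

section Vandermonde

variable (K : Type*) [Field K] {n : ℕ}

/-- The Vandermonde product of a column. -/
noncomputable def vandermondeProd (A : Finset (Fin n)) : MvPolynomial (Fin n) K :=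
  ∏ q ∈ colPairs A, (X q.1 - X q.2)

/-- The product of the Vandermonde products of the columns `C 0, …, C (B - 1)`. -/
noncomputable def colPoly (B : ℕ) (C : ℕ → Finset (Fin n)) : MvPolynomial (Fin n) K :=
  ∏ j ∈ Finset.range B, vandermondeProd K (C j)

variable {K}

theorem X_sub_X_ne_zero {a b : Fin n} (h : a ≠ b) : (X a - X b : MvPolynomial (Fin n) K) ≠ 0 :=
  sub_ne_zero.2 fun he => h (X_injective he)

theorem lt_of_mem_colPairs {A : Finset (Fin n)} {q : Fin n × Fin n} (hq : q ∈ colPairs A) :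
    q.1 < q.2 :=
  (Finset.mem_filter.1 hq).2

theorem vandermondeProd_ne_zero (A : Finset (Fin n)) : vandermondeProd K A ≠ 0 :=
  Finset.prod_ne_zero_iff.2 fun _ hq => X_sub_X_ne_zero (lt_of_mem_colPairs hq).ne

theorem colPoly_ne_zero (B : ℕ) (C : ℕ → Finset (Fin n)) : colPoly K B C ≠ 0 :=
  Finset.prod_ne_zero_iff.2 fun _ _ => vandermondeProd_ne_zero _

theorem degree_X_sub_X {a b : Fin n} (h : a < b) :
    (lexOrder n).degree (X a - X b : MvPolynomial (Fin n) K) = Finsupp.single b 1 := by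
  rw [← neg_sub, MonomialOrder.degree_neg, MonomialOrder.degree_sub_of_lt, MonomialOrder.degree_X]
  rw [MonomialOrder.degree_X, MonomialOrder.degree_X, lexOrder_lt_iff]
  refine ⟨b, fun j hj => ?_, ?_⟩
  · rw [Finsupp.single_eq_of_ne (h.trans hj).ne', Finsupp.single_eq_of_ne hj.ne']
  · rw [Finsupp.single_eq_of_ne h.ne', Finsupp.single_eq_same]
    exact one_pos

theorem degree_colPoly (B : ℕ) (C : ℕ → Finset (Fin n)) :
    (lexOrder n).degree (colPoly K B C) = colExpo B C := by
  rw [colPoly, MonomialOrder.degree_prod fun _ _ => vandermondeProd_ne_zero _, colExpo]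
  refine Finset.sum_congr rfl fun j _ => ?_
  rw [vandermondeProd, MonomialOrder.degree_prod fun _ hq =>
    X_sub_X_ne_zero (lt_of_mem_colPairs hq).ne]
  exact Finset.sum_congr rfl fun q hq => degree_X_sub_X (lt_of_mem_colPairs hq)

theorem vandermondeProd_insert {A : Finset (Fin n)} {i : Fin n} (hi : i ∉ A) :
    Associated (vandermondeProd K (insert i A)) (vandermondeProd K A * ∏ y ∈ A, (X i - X y)) := by
  have hpairs : colPairs (insert i A) =
      colPairs A ∪ A.image fun y => if y < i then (y, i) else (i, y) := by
    ext ⟨x, y⟩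
    simp only [colPairs, Finset.mem_filter, Finset.mem_product, Finset.mem_insert,
      Finset.mem_union, Finset.mem_image]
    constructor
    · rintro ⟨⟨rfl | hx, rfl | hy⟩, hlt⟩
      · exact absurd hlt (lt_irrefl _)
      · exact Or.inr ⟨y, hy, by rw [if_neg hlt.not_gt]⟩
      · exact Or.inr ⟨x, hx, by rw [if_pos hlt]⟩
      · exact Or.inl ⟨⟨hx, hy⟩, hlt⟩
    · rintro (⟨⟨hx, hy⟩, hlt⟩ | ⟨z, hz, he⟩)
      · exact ⟨⟨Or.inr hx, Or.inr hy⟩, hlt⟩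
      · have hzi : z ≠ i := fun h => hi (h ▸ hz)
        split_ifs at he with hlt
        · obtain ⟨rfl, rfl⟩ := Prod.ext_iff.1 he
          exact ⟨⟨Or.inr hz, Or.inl rfl⟩, hlt⟩
        · obtain ⟨rfl, rfl⟩ := Prod.ext_iff.1 he
          exact ⟨⟨Or.inl rfl, Or.inr hz⟩, lt_of_le_of_ne (not_lt.1 hlt) hzi.symm⟩
  have hdisj : Disjoint (colPairs A) (A.image fun y => if y < i then (y, i) else (i, y)) := by
    rw [Finset.disjoint_left]
    intro q hq hq'
    obtain ⟨z, hz, rfl⟩ := Finset.mem_image.1 hq'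
    simp only [colPairs, Finset.mem_filter, Finset.mem_product] at hq
    split_ifs at hq <;> simp_all
  rw [vandermondeProd, hpairs, Finset.prod_union hdisj, Finset.prod_image]
  · refine Associated.mul_left _ (Associated.prod _ _ _ fun y _ => ?_)
    split_ifs
    · rw [← neg_sub]
      exact (Associated.refl _).neg_left
    · exact Associated.refl _
  · intro y hy z hz h
    have hyi : y ≠ i := fun h => hi (h ▸ hy)
    have hzi : z ≠ i := fun h => hi (h ▸ hz)
    simp only at h
    split_ifs at h <;> simp_all

/-- Lagrange interpolation at the nodes `X i`, `i ∈ A`: the leading coefficient 1 of `p` is the sum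
of the `p(X i) / ∏ (X i - X y)`. Multiplying by `V` clears the denominators, which are inverted in
the fraction field. -/
theorem sum_eval_mul_eq {A : Finset (Fin n)} {u : Fin n → MvPolynomial (Fin n) K}
    {V : MvPolynomial (Fin n) K} (hu : ∀ i ∈ A, V = u i * ∏ y ∈ A.erase i, (X i - X y))
    {p : Polynomial (MvPolynomial (Fin n) K)} (hp : p.Monic) (hdeg : A.card = p.natDegree + 1) :
    V = ∑ i ∈ A, u i * p.eval (X i) := by
  set L := FractionRing (MvPolynomial (Fin n) K)
  have hinj : Function.Injective (algebraMap (MvPolynomial (Fin n) K) L) :=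
    IsFractionRing.injective _ _
  have hXinj : Set.InjOn (fun i : Fin n => algebraMap (MvPolynomial (Fin n) K) L (X i)) A :=
    fun i _ j _ h => X_injective (hinj h)
  have hp' : (p.map (algebraMap _ L)).Monic := hp.map _
  have key := Lagrange.leadingCoeff_eq_sum hXinj (P := p.map (algebraMap _ L)) (by
    rw [Polynomial.degree_eq_natDegree hp'.ne_zero, hp.natDegree_map, hdeg]
    norm_cast)
  rw [hp'.leadingCoeff] at key
  apply hinj
  rw [← mul_one (algebraMap _ L V), key, Finset.mul_sum, map_sum]
  refine Finset.sum_congr rfl fun i hi => ?_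
  have hne : ∏ y ∈ A.erase i, (algebraMap (MvPolynomial (Fin n) K) L (X i) -
      algebraMap (MvPolynomial (Fin n) K) L (X y)) ≠ 0 := by
    refine Finset.prod_ne_zero_iff.2 fun y hy => sub_ne_zero.2 fun h => ?_
    exact (Finset.ne_of_mem_erase hy) (X_injective (hinj h)).symm
  rw [Polynomial.eval_map_algebraMap, Polynomial.aeval_algebraMap_apply, hu i hi]
  simp only [map_mul, map_prod, map_sub]
  rw [mul_assoc, mul_div_cancel₀ _ hne]
  rfl

/-- The exchange relation: a product of Vandermonde products of a longer column `A` and a shorter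
column `B` is a combination of those obtained by moving one letter from `A` to `B`. -/
theorem vandermondeProd_mul_mem {A B : Finset (Fin n)} (hAB : B.card < A.card)
    {J : Ideal (MvPolynomial (Fin n) K)} {R : MvPolynomial (Fin n) K}
    (hJ : ∀ i ∈ A, i ∉ B →
      vandermondeProd K (A.erase i) * vandermondeProd K (insert i B) * R ∈ J) :
    vandermondeProd K A * vandermondeProd K B * R ∈ J := by
  have hu : ∀ i ∈ A, ∃ u, vandermondeProd K A =
      (u * vandermondeProd K (A.erase i)) * ∏ y ∈ A.erase i, (X i - X y) := by
    intro i hi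
    obtain ⟨u, hu⟩ := (vandermondeProd_insert (K := K) (Finset.notMem_erase i A)).symm
    rw [Finset.insert_erase hi] at hu
    exact ⟨u, by rw [← hu]; ring⟩
  choose! u hu using hu
  have hmonic : (∏ y ∈ B, (Polynomial.X - Polynomial.C (X y : MvPolynomial (Fin n) K))).Monic :=
    Polynomial.monic_prod_of_monic _ _ fun y _ => Polynomial.monic_X_sub_C _
  have hdeg : (∏ y ∈ B, (Polynomial.X - Polynomial.C (X y : MvPolynomial (Fin n) K))).natDegree =
      B.card := by
    rw [Polynomial.natDegree_prod_of_monic _ _ fun y _ => Polynomial.monic_X_sub_C _]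
    simp
  -- Interpolate `X ^ (|A| - 1 - |B|) * ∏ (X - X y)` over `y ∈ B`. The power brings the degree to
  -- `|A| - 1`; the product kills the terms with `i ∈ B` and, for the others, turns the Vandermonde
  -- product of `B` into that of `insert i B` up to a unit.
  have hmonic' := (Polynomial.monic_X_pow (R := MvPolynomial (Fin n) K)
    (A.card - 1 - B.card)).mul hmonic
  have key := sum_eval_mul_eq hu hmonic' (by
    rw [(Polynomial.monic_X_pow _).natDegree_mul hmonic, hdeg, Polynomial.natDegree_X_pow]
    omega)
  rw [key, Finset.sum_mul, Finset.sum_mul]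
  refine J.sum_mem fun i hi => ?_
  simp only [Polynomial.eval_mul, Polynomial.eval_pow, Polynomial.eval_X, Polynomial.eval_prod,
    Polynomial.eval_sub, Polynomial.eval_C]
  by_cases hiB : i ∈ B
  · rw [Finset.prod_eq_zero hiB (sub_self _)]
    simp
  · obtain ⟨c, hc⟩ := (vandermondeProd_insert (K := K) hiB).dvd
    have : u i * vandermondeProd K (A.erase i) *
        (X i ^ (A.card - 1 - B.card) * ∏ y ∈ B, (X i - X y)) * vandermondeProd K B * R =
        (u i * X i ^ (A.card - 1 - B.card) * c) *
          (vandermondeProd K (A.erase i) * vandermondeProd K (insert i B) * R) := by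
      linear_combination (u i * vandermondeProd K (A.erase i) *
        X i ^ (A.card - 1 - B.card) * R) * hc
    rw [this]
    exact J.mul_mem_left _ (hJ i hi hiB)

/-- The ideal generated by the products of Vandermonde products of columns with lengths `g`, in
which the letter `e` occurs `w e` times. -/
noncomputable def colIdeal (K : Type*) [Field K] (B : ℕ) (g : ℕ → ℕ) (w : Fin n → ℕ) :
    Ideal (MvPolynomial (Fin n) K) :=
  Ideal.span {f | ∃ C : ℕ → Finset (Fin n), (∀ j, (C j).card = g j) ∧
    (∀ e, ((Finset.range B).filter fun j => e ∈ C j).card = w e) ∧ f = colPoly K B C}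

/-- Each step of `dominance_induction` moves a box from a longer to a shorter column, and the
exchange relation realizes it by moving a letter. The content `w` is unchanged. -/
theorem colPoly_mem_colIdeal {B N : ℕ} {g h : ℕ → ℕ} {w : Fin n → ℕ} (hg : IsShape B N g)
    (hh : IsShape B N h) (hd : ColDominated h g) {C : ℕ → Finset (Fin n)}
    (hC : ∀ j, (C j).card = h j)
    (hw : ∀ e, ((Finset.range B).filter fun j => e ∈ C j).card = w e) :
    colPoly K B C ∈ colIdeal K B g w := by
  classical
  refine dominance_induction hg (P := fun h => ∀ C : ℕ → Finset (Fin n), (∀ j, (C j).card = h j) →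
    (∀ e, ((Finset.range B).filter fun j => e ∈ C j).card = w e) →
      colPoly K B C ∈ colIdeal K B g w) ?_ ?_ h hh hd C hC hw
  · intro C hC hw
    exact Ideal.subset_span ⟨C, hC, hw, rfl⟩
  · intro h h' p q hh hh' hpq hqB hgap hm ih C hC hw
    have hp : p ∈ Finset.range B := by simp; omega
    have hq : q ∈ (Finset.range B).erase p := by simp; omega
    have hsplit : ∀ C : ℕ → Finset (Fin n), colPoly K B C =
        vandermondeProd K (C p) * vandermondeProd K (C q) *
          ∏ j ∈ ((Finset.range B).erase p).erase q, vandermondeProd K (C j) := by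
      intro C
      rw [colPoly, ← Finset.mul_prod_erase _ _ hp, ← Finset.mul_prod_erase _ _ hq, mul_assoc]
    rw [hsplit]
    apply vandermondeProd_mul_mem
    · rw [hC, hC]
      omega
    · intro i hip hiq
      obtain ⟨C', hC'⟩ : ∃ C' : ℕ → Finset (Fin n), ∀ j, C' j =
          if j = p then (C p).erase i else if j = q then insert i (C q) else C j :=
        ⟨_, fun _ => rfl⟩
      have hp' : C' p = (C p).erase i := by rw [hC', if_pos rfl]
      have hq' : C' q = insert i (C q) := by rw [hC', if_neg hpq.ne', if_pos rfl]
      have hr' : ∀ j, j ≠ p → j ≠ q → C' j = C j := fun j h1 h2 => by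
        rw [hC', if_neg h1, if_neg h2]
      have := ih C' ?_ ?_
      · rw [hsplit, hp', hq'] at this
        convert this using 2
        refine Finset.prod_congr rfl fun j hj => ?_
        rw [hr' j (by simp_all) (by simp_all)]
      · intro j
        have h1 := hm j
        by_cases hjp : j = p
        · subst hjp
          rw [hp', Finset.card_erase_of_mem hip, hC]
          rw [if_neg hpq.ne, if_pos rfl] at h1
          omega
        · by_cases hjq : j = q
          · subst hjq
            rw [hq', Finset.card_insert_of_notMem hiq, hC]
            rw [if_neg hjp, if_pos rfl] at h1
            omega
          · rw [hr' j hjp hjq, hC]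
            rw [if_neg hjp, if_neg hjq] at h1
            omega
      · intro e
        rw [← hw e]
        simp only [Finset.card_filter]
        rw [← Finset.add_sum_erase _ _ hp, ← Finset.add_sum_erase _ _ hq,
          ← Finset.add_sum_erase (Finset.range B) (fun j => if e ∈ C j then 1 else 0) hp,
          ← Finset.add_sum_erase _ (fun j => if e ∈ C j then 1 else 0) hq,
          ← add_assoc, ← add_assoc]
        congr 1
        · rw [hp', hq']
          by_cases he : e = i
          · subst he
            simp [hip, hiq]
          · simp [he]
        · refine Finset.sum_congr rfl fun j hj => ?_
          rw [hr' j (by simp_all) (by simp_all)]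

end Vandermonde

end SpechtIdeals

/-! ### Restriction of the ideal to lines in the direction of the last variable -/

namespace SpechtIdeals

open MvPolynomial

section Fibre

variable {K : Type*} [Field K] {m : ℕ}

/-- The restriction of a polynomial to the line of points whose first `m` coordinates are `a`. -/
noncomputable def fibreHom (a : Fin m → K) : MvPolynomial (Fin (m + 1)) K →+* Polynomial K :=
  (Polynomial.mapRingHom (eval a)).comp (toPolyLast K m : _ →+* _)

theorem fibreHom_apply (a : Fin m → K) (f : MvPolynomial (Fin (m + 1)) K) :
    fibreHom a f = (toPolyLast K m f).map (eval a) :=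
  rfl

@[simp]
theorem fibreHom_X_castSucc (a : Fin m → K) (i : Fin m) :
    fibreHom a (X i.castSucc) = Polynomial.C (a i) := by
  simp [fibreHom_apply, toPolyLast]

@[simp]
theorem fibreHom_X_last (a : Fin m → K) : fibreHom a (X (Fin.last m)) = Polynomial.X := by
  simp [fibreHom_apply, toPolyLast]

theorem injOn_of_fibreHom_ne_zero {a : Fin m → K} {B : ℕ} {D : ℕ → Finset (Fin m)} {L : Finset ℕ}
    (h : fibreHom a (colPoly K B (extendCols D L)) ≠ 0) {j : ℕ} (hj : j < B) :
    Set.InjOn a (D j) := by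
  rw [colPoly, map_prod, Finset.prod_ne_zero_iff] at h
  have h1 := h j (Finset.mem_range.2 hj)
  rw [vandermondeProd, map_prod, Finset.prod_ne_zero_iff] at h1
  have key : ∀ x ∈ D j, ∀ y ∈ D j, x < y → a x ≠ a y := by
    intro x hx y hy hxy he
    apply h1 (x.castSucc, y.castSucc)
    · simp [colPairs, hx, hy, hxy]
    · simp [he]
  intro x hx y hy he
  rcases lt_trichotomy x y with hlt | rfl | hlt
  · exact absurd he (key x hx y hy hlt)
  · rfl
  · exact absurd he.symm (key y hy x hx hlt)

/-- A column that holds the last letter and a letter with coordinate `v` contributes a factor `v -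
X` on the line. -/
theorem pow_dvd_fibreHom [DecidableEq K] (a : Fin m → K) {B : ℕ} (D : ℕ → Finset (Fin m))
    {L : Finset ℕ} (hL : L ⊆ Finset.range B) (v : K) :
    (Polynomial.X - Polynomial.C v) ^ (L.filter fun j => v ∈ (D j).image a).card ∣
      fibreHom a (colPoly K B (extendCols D L)) := by
  rw [colPoly, map_prod, ← Finset.prod_const]
  refine (Finset.prod_dvd_prod_of_dvd _ (fun j => fibreHom a (vandermondeProd K (extendCols D L j)))
    fun j hj => ?_).trans
    (Finset.prod_dvd_prod_of_subset _ _ _ ((Finset.filter_subset _ _).trans hL))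
  obtain ⟨hjL, hjv⟩ := Finset.mem_filter.1 hj
  obtain ⟨i, hi, rfl⟩ := Finset.mem_image.1 hjv
  rw [vandermondeProd, map_prod]
  refine Dvd.dvd.trans ?_ (Finset.dvd_prod_of_mem _ (show (i.castSucc, Fin.last m) ∈ _ by
    simp [colPairs, hi, hjL, Fin.castSucc_lt_last]))
  rw [map_sub, fibreHom_X_castSucc, fibreHom_X_last, ← neg_sub, neg_dvd]

theorem exists_eq_extendCols {B N : ℕ} {g : ℕ → ℕ} (hg : IsShape B N g)
    {C : ℕ → Finset (Fin (m + 1))} (hC : ∀ j, (C j).card = g j) :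
    ∃ D L, L ⊆ Finset.range B ∧ C = extendCols D L := by
  classical
  refine ⟨fun j => Finset.univ.filter fun i : Fin m => i.castSucc ∈ C j,
    (Finset.range B).filter fun j => Fin.last m ∈ C j, Finset.filter_subset _ _, ?_⟩
  ext j e
  induction e using Fin.lastCases with
  | last =>
    simp only [last_mem_extendCols, Finset.mem_filter, Finset.mem_range, iff_and_self]
    exact fun h => hg.lt_of_pos (by rw [← hC]; exact Finset.card_pos.2 ⟨_, h⟩)
  | cast e => simp

/-- A polynomial in the ideal of a shape `g` with `l` copies of the last letter: its leading
coefficient with respect to the last variable vanishes at all points whose type cannot be extended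
by a cheap enough horizontal strip to a shape dominated by `g`. -/
theorem leadingCoeff_vanishes_of_mem_colIdeal [DecidableEq K] {B l : ℕ} (hm : m ≤ B) {g : ℕ → ℕ}
    (hg : IsShape B (m + l) g) {F : Set (ℕ → ℕ)} (hgF : g ∈ F)
    {f : MvPolynomial (Fin (m + 1)) K}
    (hf : f ∈ colIdeal K B g (Fin.snoc (fun _ => 1) l : Fin (m + 1) → ℕ)) (a : Fin m → K)
    (ha : pointType a ∉ stripShapes B m l (toPolyLast K m f).natDegree F) :
    eval a (toPolyLast K m f).leadingCoeff = 0 := by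
  set d := (toPolyLast K m f).natDegree with hd
  have hshape := isShape_pointType hm a
  -- `Q` is a common divisor of all generators on the line above `a`. It is 0 if they all vanish
  -- there, and otherwise it is read off from the cheapest strip.
  obtain ⟨Q, hQd, hQ⟩ : ∃ Q : Polynomial K, (Q = 0 ∨ d < Q.natDegree) ∧
      ∀ C : ℕ → Finset (Fin (m + 1)), (∀ j, (C j).card = g j) →
        (∀ e, ((Finset.range B).filter fun j => e ∈ C j).card =
          (Fin.snoc (fun _ => 1) l : Fin (m + 1) → ℕ) e) →
        Q ∣ fibreHom a (colPoly K B C) := by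
    by_cases hall : ∀ C : ℕ → Finset (Fin (m + 1)), (∀ j, (C j).card = g j) →
        (∀ e, ((Finset.range B).filter fun j => e ∈ C j).card =
          (Fin.snoc (fun _ => 1) l : Fin (m + 1) → ℕ) e) → fibreHom a (colPoly K B C) = 0
    · exact ⟨0, Or.inl rfl, fun C h1 h2 => by rw [hall C h1 h2]⟩
    have hcols : ∀ C : ℕ → Finset (Fin (m + 1)), (∀ j, (C j).card = g j) →
        (∀ e, ((Finset.range B).filter fun j => e ∈ C j).card =
          (Fin.snoc (fun _ => 1) l : Fin (m + 1) → ℕ) e) → fibreHom a (colPoly K B C) ≠ 0 →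
        ∃ D L, L ⊆ Finset.range B ∧ L.card = l ∧ C = extendCols D L ∧
          (∀ j, Set.InjOn a (D j)) ∧ (∀ i j j', i ∈ D j → i ∈ D j' → j = j') ∧
          ∀ k, ∑ j ∈ Finset.range k, g j =
            ∑ j ∈ Finset.range k, (D j).card + (L.filter (· < k)).card := by
      intro C hC hw hne
      obtain ⟨D, L, hL, rfl⟩ := exists_eq_extendCols hg hC
      have hDB : ∀ j i, i ∈ D j → j < B := fun j i hi => hg.lt_of_pos (by
        rw [← hC]; exact Finset.card_pos.2 ⟨i.castSucc, by simpa⟩)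
      refine ⟨D, L, hL, ?_, rfl, ?_, ?_, ?_⟩
      · have := hw (Fin.last m)
        simp only [last_mem_extendCols, Fin.snoc_last] at this
        rwa [Finset.filter_mem_eq_inter, Finset.inter_eq_right.2 hL] at this
      · intro j
        by_cases hj : j < B
        · exact injOn_of_fibreHom_ne_zero hne hj
        · exact fun i hi => absurd (hDB j i hi) hj
      · intro i j j' hij hij'
        have := hw i.castSucc
        simp only [castSucc_mem_extendCols, Fin.snoc_castSucc] at this
        apply Finset.card_le_one.1 this.le
        · simp [hij, hDB j i hij]
        · simp [hij', hDB j' i hij']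
      · intro k
        rw [← Finset.sum_congr rfl fun j _ => hC j]
        simp only [card_extendCols, Finset.sum_add_distrib]
        rw [← Finset.card_filter, Finset.filter_mem_eq_inter]
        congr 2
        ext j
        simp
        tauto
    push Not at hall
    obtain ⟨C, hC, hw, hne⟩ := hall
    -- A single generator that survives on the line shows that `g` exceeds the type of `a` by no
    -- more than a strip of `l` boxes can supply.
    obtain ⟨D, L, hLB, hLl, -, hinj, hdisj, hsum⟩ := hcols C hC hw hne
    obtain ⟨S, hSB, hSl, hS, hSmin⟩ := exists_minimal_strip (l := l) hshape hg
      (fun k => by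
        rw [hsum]
        refine Nat.add_le_add (sum_card_le_sum_pointType hinj hdisj k) ?_
        conv_rhs => rw [← Finset.card_range k]
        refine Finset.card_le_card fun j hj => ?_
        simpa using (Finset.mem_filter.1 hj).2)
      (fun k => by
        rw [hsum, ← hLl]
        exact Nat.add_le_add (sum_card_le_sum_pointType hinj hdisj k) (Finset.card_filter_le _ _))
    refine ⟨∏ v ∈ Finset.univ.image a,
      (Polynomial.X - Polynomial.C v) ^ (S.filter (· < valueMult a v)).card, Or.inr ?_, ?_⟩
    -- By double counting, the degree of `Q` is the cost of `S`; were it at most `d`, the type of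
    -- `a` would belong to `stripShapes`.
    · rw [Polynomial.natDegree_prod_of_monic _ _
        fun v _ => (Polynomial.monic_X_sub_C v).pow _]
      simp only [Polynomial.natDegree_pow, Polynomial.natDegree_X_sub_C, mul_one]
      rw [← sum_pointType]
      by_contra hc
      exact ha ⟨hshape, g, hgF, S, hSB, hSl, not_lt.1 hc, hS⟩
    · intro C hC hw
      by_cases hne : fibreHom a (colPoly K B C) = 0
      · rw [hne]
        exact dvd_zero _
      obtain ⟨D, L, hLB, hLl, rfl, hinj, hdisj, hsum⟩ := hcols C hC hw hne
      apply Finset.prod_dvd_of_coprime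
      · intro v _ w _ hvw
        exact (Polynomial.isCoprime_X_sub_C_of_isUnit_sub
          (sub_ne_zero.2 hvw).isUnit).pow
      · intro v hv
        -- Minimality of `S` is applied with `k` the multiplicity of `v` and `t` the number of
        -- columns of `L` in which `v` occurs; `sum_card_add_le` is the required inequality.
        refine (pow_dvd_pow _ ?_).trans (pow_dvd_fibreHom a D hLB v)
        apply hSmin
        intro k
        rw [hsum]
        exact sum_card_add_le hinj hdisj L hv k
  have hmem : Q ∣ fibreHom a f := by
    rw [← Ideal.mem_span_singleton, ← Ideal.mem_comap]
    refine (Ideal.span_le.2 ?_ : colIdeal K B g _ ≤ _) hf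
    rintro _ ⟨C, hC, hw, rfl⟩
    exact Ideal.mem_span_singleton.2 (hQ C hC hw)
  have hzero : fibreHom a f = 0 := by
    rcases hQd with rfl | hQd
    · exact zero_dvd_iff.1 hmem
    · exact Polynomial.eq_zero_of_dvd_of_natDegree_lt hmem
        (Polynomial.natDegree_map_le.trans_lt hQd)
  have := congrArg (fun p => p.coeff d) hzero
  simpa [fibreHom_apply, Polynomial.coeff_map, hd] using this

/-- The shapes dominated by `g`. -/
def lowerShapes (B N : ℕ) (g : ℕ → ℕ) : Set (ℕ → ℕ) :=
  {h | IsShape B N h ∧ ColDominated h g}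

theorem isLowerShapes_lowerShapes (B N : ℕ) (g : ℕ → ℕ) :
    IsLowerShapes B N (lowerShapes B N g) :=
  ⟨fun _ hh => hh.1, fun _ hh _ hh' hd => ⟨hh', fun k => (hh.2 k).trans (hd k)⟩⟩

/-- Membership in the ideal is used only for the last variable, the one with repeated letters. Its
leading coefficient involves letters of multiplicity one, for which vanishing by type is enough. -/
theorem hasStdDivisor_of_mem_colIdeal [Infinite K] {B l : ℕ} (hm : m ≤ B) {g : ℕ → ℕ}
    (hg : IsShape B (m + l) g) {f : MvPolynomial (Fin (m + 1)) K}
    (hf : f ∈ colIdeal K B g (Fin.snoc (fun _ => 1) l : Fin (m + 1) → ℕ)) (hf0 : f ≠ 0) :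
    HasStdDivisor B (lowerShapes B (m + l) g) (Fin.snoc (fun _ => 1) l : Fin (m + 1) → ℕ) f := by
  classical
  exact hasStdDivisor_of_leadingCoeff (isLowerShapes_lowerShapes _ _ _) hf0
    (hasStdDivisor_of_vanishes hm (stripShapes_isLower _ _ _ _ _)
      (Polynomial.leadingCoeff_ne_zero.2 (toPolyLast_ne_zero hf0))
      (leadingCoeff_vanishes_of_mem_colIdeal hm hg
        (show g ∈ lowerShapes B (m + l) g from ⟨hg, fun _ => le_rfl⟩) hf))

end Fibre

end SpechtIdeals

/-! ### Young diagrams in terms of column lengths -/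

namespace SpechtIdeals

open MvPolynomial

section Diagrams

theorem sum_ite_mem_row (mu : YoungDiagram) {B : ℕ} (hB : mu.card ≤ B) (i : ℕ) :
    ∑ j ∈ Finset.range B, (if (i, j) ∈ mu then 1 else 0) = mu.rowLen i := by
  rw [← Finset.card_filter, mu.rowLen_eq_card]
  symm
  have hle : mu.rowLen i ≤ B := by
    rw [mu.rowLen_eq_card]
    exact (Finset.card_filter_le _ _).trans hB
  rw [← mu.rowLen_eq_card]
  conv_lhs => rw [← Finset.card_range (mu.rowLen i)]
  congr 1
  ext j
  simp only [Finset.mem_filter, Finset.mem_range, YoungDiagram.mem_iff_lt_rowLen]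
  omega

theorem min_colLen_eq_sum (mu : YoungDiagram) (i j : ℕ) :
    min i (mu.colLen j) = ∑ k ∈ Finset.range i, if (k, j) ∈ mu then 1 else 0 := by
  rw [← Finset.card_filter]
  conv_lhs => rw [← Finset.card_range (min i (mu.colLen j))]
  congr 1
  ext k
  simp [YoungDiagram.mem_iff_lt_colLen]

theorem sum_rowLen (mu : YoungDiagram) {B : ℕ} (hB : mu.card ≤ B) (i : ℕ) :
    ∑ k ∈ Finset.range i, mu.rowLen k = ∑ j ∈ Finset.range B, min i (mu.colLen j) := by
  simp only [min_colLen_eq_sum, ← sum_ite_mem_row mu hB]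
  exact Finset.sum_comm

theorem lt_card_of_mem (mu : YoungDiagram) {i j : ℕ} (h : (i, j) ∈ mu) : j < mu.card := by
  rw [YoungDiagram.mem_iff_lt_rowLen] at h
  refine h.trans_le ?_
  rw [mu.rowLen_eq_card]
  exact Finset.card_filter_le _ _

theorem isShape_colLen {mu : YoungDiagram} {B : ℕ} (hB : mu.card ≤ B) :
    IsShape B mu.card mu.colLen := by
  refine ⟨fun i j hij => mu.colLen_anti i j hij, fun j hj => ?_, ?_⟩
  · by_contra h
    have := lt_card_of_mem mu (mu.mem_iff_lt_colLen.2 (Nat.pos_of_ne_zero h))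
    omega
  · rw [YoungDiagram.card, Finset.card_eq_sum_card_fiberwise (t := Finset.range B)
      (f := fun c : ℕ × ℕ => c.2)]
    · exact Finset.sum_congr rfl fun j _ => mu.colLen_eq_card
    · intro c hc
      have := lt_card_of_mem mu (i := c.1) (j := c.2) hc
      simp
      omega

/-- With `i = mu.colLen k`, comparing the first `i` rows and using equal sizes shows that `mu` has
at least as many cells below row `i` as `nu`. For `mu` these cells all lie in the first `k` columns,
whose total is thus `k * i` plus their number; for `nu` the same expression is only an upper bound.
-/
theorem colDominated_of_dominated {mu nu : YoungDiagram} (hcard : mu.card = nu.card)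
    (hd : Dominated mu nu) : ColDominated mu.colLen nu.colLen := by
  intro k
  have hmu := isShape_colLen (mu := mu) le_rfl
  have hnu := isShape_colLen (mu := nu) hcard.ge
  rcases le_total mu.card k with hk | hk
  · rw [hmu.sum_range_of_le hk, hnu.sum_range_of_le hk, hcard]
  set i := mu.colLen k with hi
  have h1 := hd i
  rw [sum_rowLen mu le_rfl, sum_rowLen nu hcard.ge] at h1
  have htot : ∀ h : ℕ → ℕ, ∑ j ∈ Finset.range mu.card, h j =
      ∑ j ∈ Finset.range mu.card, min i (h j) + ∑ j ∈ Finset.range mu.card, (h j - i) := by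
    intro h
    rw [← Finset.sum_add_distrib]
    exact Finset.sum_congr rfl fun j _ => by omega
  have h2 := htot mu.colLen
  have h3 := htot nu.colLen
  rw [hmu.2.2] at h2
  rw [hnu.2.2] at h3
  have h4 : ∑ j ∈ Finset.range mu.card, (mu.colLen j - i) =
      ∑ j ∈ Finset.range k, (mu.colLen j - i) := by
    symm
    apply Finset.sum_subset (Finset.range_mono hk)
    intro j _ hj
    have := mu.colLen_anti k j (by simpa using hj)
    omega
  have h5 : ∑ j ∈ Finset.range k, (mu.colLen j - i) + k * i =
      ∑ j ∈ Finset.range k, mu.colLen j := by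
    rw [← Finset.card_range k, ← smul_eq_mul, ← Finset.sum_const, Finset.card_range,
      ← Finset.sum_add_distrib]
    refine Finset.sum_congr rfl fun j hj => ?_
    have := mu.colLen_anti j k (Finset.mem_range.1 hj).le
    omega
  have h6 : ∑ j ∈ Finset.range k, nu.colLen j ≤
      ∑ j ∈ Finset.range k, (nu.colLen j - i) + k * i := by
    rw [← Finset.card_range k, ← smul_eq_mul, ← Finset.sum_const, Finset.card_range,
      ← Finset.sum_add_distrib]
    exact Finset.sum_le_sum fun j _ => by omega
  have h7 : ∑ j ∈ Finset.range k, (nu.colLen j - i) ≤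
      ∑ j ∈ Finset.range mu.card, (nu.colLen j - i) :=
    Finset.sum_le_sum_of_subset (Finset.range_mono hk)
  omega

/-- Conjugation reverses dominance, so the converse is the direct implication for the transposed
diagrams. -/
theorem dominated_iff_colDominated {mu nu : YoungDiagram} (hcard : mu.card = nu.card) :
    Dominated mu nu ↔ ColDominated mu.colLen nu.colLen := by
  refine ⟨colDominated_of_dominated hcard, fun h => ?_⟩
  have hT : ∀ rho : YoungDiagram, rho.transpose.card = rho.card := fun rho => by
    simp [YoungDiagram.card, YoungDiagram.transpose]
  have := colDominated_of_dominated (mu := nu.transpose) (nu := mu.transpose)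
    (by rw [hT, hT, hcard]) (by
      intro i
      simpa only [YoungDiagram.rowLen_transpose] using h i)
  intro i
  simpa only [YoungDiagram.colLen_transpose] using this i

theorem exists_diagram {B N : ℕ} {h : ℕ → ℕ} (hh : IsShape B N h) :
    ∃ mu : YoungDiagram, mu.colLen = h ∧ mu.card = N := by
  obtain ⟨mu, hmu⟩ : ∃ mu : YoungDiagram, ∀ i j, (i, j) ∈ mu ↔ i < h j := by
    refine ⟨⟨(Finset.range (h 0) ×ˢ Finset.range B).filter fun c => c.1 < h c.2, ?_⟩, ?_⟩
    · intro c d hdc hc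
      have h1 := hdc.1
      have h2 := hdc.2
      have h3 := hh.1 h2
      simp only [Finset.coe_filter, Finset.mem_product, Finset.mem_range,
        Set.mem_ofPred_eq] at hc ⊢
      omega
    · intro i j
      rw [← YoungDiagram.mem_cells]
      simp only [Finset.mem_filter, Finset.mem_product, Finset.mem_range, and_iff_right_iff_imp]
      intro hi
      have h1 := hh.1 (Nat.zero_le j)
      exact ⟨by omega, hh.lt_of_pos (by omega)⟩
  have hcol : mu.colLen = h := by
    funext j
    apply le_antisymm
    · by_contra hc
      exact lt_irrefl _ ((hmu _ j).1 (mu.mem_iff_lt_colLen.2 (not_le.1 hc)))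
    · by_contra hc
      exact lt_irrefl _ (mu.mem_iff_lt_colLen.1 ((hmu _ j).2 (not_le.1 hc)))
  refine ⟨mu, hcol, ?_⟩
  have h1 := isShape_colLen (mu := mu) le_rfl
  rw [← h1.sum_range_of_le (le_max_left _ B), hcol, hh.sum_range_of_le (le_max_right _ B)]

end Diagrams

/-! ### Tableaux in terms of column sets -/

section Tableaux

variable {n l : ℕ} {lam : YoungDiagram}

/-- The sets of entries of the columns of a tableau. -/
def Tab.cols (T : Tab n l lam) (j : ℕ) : Finset (Fin n) :=
  (Finset.univ.filter fun c : {c : ℕ × ℕ // c ∈ lam.cells} => c.1.2 = j).image T.entry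

theorem Tab.mem_cols {T : Tab n l lam} {j : ℕ} {e : Fin n} :
    e ∈ T.cols j ↔ ∃ c, c.1.2 = j ∧ T.entry c = e := by
  simp [Tab.cols]

theorem Tab.card_cols (T : Tab n l lam) (j : ℕ) : (T.cols j).card = lam.colLen j := by
  rw [Tab.cols, Finset.card_image_of_injOn, lam.colLen_eq_card]
  · apply Finset.card_bij (fun c _ => c.1)
    · intro c hc
      rw [YoungDiagram.mem_col_iff]
      exact ⟨c.2, (Finset.mem_filter.1 hc).2⟩
    · intro c _ d _ h
      exact Subtype.ext h
    · intro c hc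
      rw [YoungDiagram.mem_col_iff] at hc
      exact ⟨⟨c, hc.1⟩, by simpa using hc.2, rfl⟩
  · intro c hc d hd h
    simp only [Finset.coe_filter, Set.mem_ofPred_eq] at hc hd
    exact T.col_injective c d (by rw [hc.2, hd.2]) h

theorem Tab.card_filter_mem_cols (T : Tab n l lam) {B : ℕ} (hB : lam.card ≤ B) (e : Fin n) :
    ((Finset.range B).filter fun j => e ∈ T.cols j).card =
      if (e : ℕ) + 1 = n then l else 1 := by
  rw [← T.content e]
  symm
  apply Finset.card_bij (fun c _ => c.1.2)
  · intro c hc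
    have := lt_card_of_mem lam (i := c.1.1) (j := c.1.2) c.2
    simp only [Finset.mem_filter, Finset.mem_range, Tab.mem_cols]
    exact ⟨by omega, c, rfl, (Finset.mem_filter.1 hc).2⟩
  · intro c hc d hd h
    exact T.col_injective c d h ((Finset.mem_filter.1 hc).2.trans (Finset.mem_filter.1 hd).2.symm)
  · intro j hj
    obtain ⟨c, hc, he⟩ := Tab.mem_cols.1 (Finset.mem_filter.1 hj).2
    exact ⟨c, by simpa using he, hc⟩

variable (K : Type*) [Field K]

/-- Taking `min` and `max` orients each pair as in `colPairs`. The factors thus differ from those of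
the Specht polynomial only by signs, and not at all if the columns increase. -/
theorem Tab.colPoly_cols (T : Tab n l lam) {B : ℕ} (hB : lam.card ≤ B) :
    colPoly K B T.cols =
      ∏ p : {c : ℕ × ℕ // c ∈ lam.cells} × {c : ℕ × ℕ // c ∈ lam.cells} with
        p.1.1.2 = p.2.1.2 ∧ p.1.1.1 < p.2.1.1,
      (X (min (T.entry p.1) (T.entry p.2)) - X (max (T.entry p.1) (T.entry p.2))) := by
  have hne : ∀ c d : {c : ℕ × ℕ // c ∈ lam.cells}, c.1.2 = d.1.2 → c.1.1 < d.1.1 →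
      T.entry c ≠ T.entry d := fun c d h1 h2 h => by
    rw [T.col_injective c d h1 h] at h2
    exact lt_irrefl _ h2
  simp only [colPoly, vandermondeProd]
  rw [Finset.prod_sigma']
  symm
  refine Finset.prod_bij (fun p _ => ⟨p.1.1.2, (min (T.entry p.1) (T.entry p.2),
    max (T.entry p.1) (T.entry p.2))⟩) ?_ ?_ ?_ ?_
  · rintro ⟨c, d⟩ hp
    simp only [Finset.mem_filter, Finset.mem_univ, true_and] at hp
    have h1 := lt_card_of_mem lam (i := c.1.1) (j := c.1.2) c.2
    have hc : T.entry c ∈ T.cols c.1.2 := Tab.mem_cols.2 ⟨c, rfl, rfl⟩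
    have hd : T.entry d ∈ T.cols c.1.2 := Tab.mem_cols.2 ⟨d, hp.1.symm, rfl⟩
    simp only [Finset.mem_sigma, Finset.mem_range, colPairs, Finset.mem_filter,
      Finset.mem_product]
    refine ⟨by omega, ⟨?_, ?_⟩, ?_⟩
    · rcases min_choice (T.entry c) (T.entry d) with h | h <;> rwa [h]
    · rcases max_choice (T.entry c) (T.entry d) with h | h <;> rwa [h]
    · exact min_lt_max.2 (hne c d hp.1 hp.2)
  · rintro ⟨c, d⟩ hp ⟨c', d'⟩ hp' h
    simp only [Finset.mem_filter, Finset.mem_univ, true_and] at hp hp'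
    simp only [Sigma.mk.injEq, heq_eq_eq, Prod.mk.injEq] at h
    obtain ⟨hcol, hmin, hmax⟩ := h
    have key : (T.entry c = T.entry c' ∧ T.entry d = T.entry d') ∨
        (T.entry c = T.entry d' ∧ T.entry d = T.entry c') := by
      rcases le_total (T.entry c) (T.entry d) with h1 | h1 <;>
      rcases le_total (T.entry c') (T.entry d') with h2 | h2 <;>
      simp only [h1, h2, min_eq_left, min_eq_right, max_eq_left, max_eq_right] at hmin hmax <;>
      tauto
    rcases key with ⟨h1, h2⟩ | ⟨h1, h2⟩
    · rw [T.col_injective c c' hcol h1, T.col_injective d d' (by omega) h2]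
    · have h3 := T.col_injective c d' (by omega) h1
      have h4 := T.col_injective d c' (by omega) h2
      rw [h3, h4] at hp
      omega
  · rintro ⟨j, x, y⟩ hq
    simp only [Finset.mem_sigma, Finset.mem_range, colPairs, Finset.mem_filter,
      Finset.mem_product] at hq
    obtain ⟨-, ⟨hx, hy⟩, hlt⟩ := hq
    obtain ⟨c, hc, rfl⟩ := Tab.mem_cols.1 hx
    obtain ⟨d, hd, rfl⟩ := Tab.mem_cols.1 hy
    rcases lt_trichotomy c.1.1 d.1.1 with h | h | h
    · exact ⟨(c, d), by simp [hc, hd, h], by simp [hc, hlt.le]⟩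
    · have : c = d := Subtype.ext (Prod.ext h (hc.trans hd.symm))
      rw [this] at hlt
      exact absurd hlt (lt_irrefl _)
    · exact ⟨(d, c), by simp [hc, hd, h], by simp [hd, hlt.le]⟩
  · intro p _
    rfl

theorem Tab.associated_specht (T : Tab n l lam) {B : ℕ} (hB : lam.card ≤ B) :
    Associated (colPoly K B T.cols) (T.specht K) := by
  rw [T.colPoly_cols K hB, Tab.specht]
  refine Associated.prod _ _ _ fun p _ => ?_
  rcases le_total (T.entry p.1) (T.entry p.2) with h | h
  · rw [min_eq_left h, max_eq_right h]
    exact Associated.refl _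
  · rw [min_eq_right h, max_eq_left h, ← neg_sub]
    exact (Associated.refl _).neg_left

theorem Tab.specht_eq_colPoly (T : Tab n l lam) {B : ℕ} (hB : lam.card ≤ B)
    (hT : ∀ c d : {c : ℕ × ℕ // c ∈ lam.cells},
      c.1.2 = d.1.2 → c.1.1 < d.1.1 → T.entry c < T.entry d) :
    T.specht K = colPoly K B T.cols := by
  rw [T.colPoly_cols K hB, Tab.specht]
  refine Finset.prod_congr rfl fun p hp => ?_
  simp only [Finset.mem_filter, Finset.mem_univ, true_and] at hp
  have h := (hT p.1 p.2 hp.1 hp.2).le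
  rw [min_eq_left h, max_eq_right h]

variable {K}

/-- The tableau with given sets of entries of the columns, each column being increasing. -/
theorem exists_tab {B : ℕ} (hB : lam.card ≤ B) {C : ℕ → Finset (Fin n)}
    (hC : ∀ j, (C j).card = lam.colLen j)
    (hw : ∀ e : Fin n, ((Finset.range B).filter fun j => e ∈ C j).card =
      if (e : ℕ) + 1 = n then l else 1) :
    ∃ T : Tab n l lam, T.cols = C ∧
      (∀ c d : {c : ℕ × ℕ // c ∈ lam.cells},
        c.1.2 = d.1.2 → c.1.1 < d.1.1 → T.entry c < T.entry d) ∧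
      (IsStdCols C → T.IsStandard) := by
  obtain ⟨E, hE⟩ : ∃ E : {c : ℕ × ℕ // c ∈ lam.cells} → Fin n, ∀ c,
      E c = (C c.1.2).orderEmbOfFin (hC c.1.2) ⟨c.1.1, lam.mem_iff_lt_colLen.1 c.2⟩ :=
    ⟨_, fun _ => rfl⟩
  have hEmem : ∀ c, E c ∈ C c.1.2 := fun c => by
    rw [hE]
    exact Finset.orderEmbOfFin_mem _ _ _
  have hEeq : ∀ c d : {c : ℕ × ℕ // c ∈ lam.cells}, c.1.2 = d.1.2 →
      (E c < E d ↔ c.1.1 < d.1.1) := by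
    rintro ⟨⟨i, j⟩, hc⟩ ⟨⟨i', j'⟩, hd⟩ h
    obtain rfl : j = j' := h
    rw [hE, hE]
    simp
  have hEinj : ∀ c d : {c : ℕ × ℕ // c ∈ lam.cells}, c.1.2 = d.1.2 → E c = E d → c = d := by
    intro c d h he
    have h1 := hEeq c d h
    have h2 := hEeq d c h.symm
    rw [he] at h1 h2
    simp only [lt_irrefl, false_iff] at h1 h2
    exact Subtype.ext (Prod.ext (by omega) h)
  have hEsurj : ∀ j, ∀ e ∈ C j, ∃ c, c.1.2 = j ∧ E c = e := by
    intro j e he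
    have : e ∈ Set.range ((C j).orderEmbOfFin (hC j)) := by
      rw [Finset.range_orderEmbOfFin]
      exact he
    obtain ⟨i, rfl⟩ := this
    exact ⟨⟨(i, j), lam.mem_iff_lt_colLen.2 i.2⟩, rfl, by rw [hE]⟩
  have hcontent : ∀ k : Fin n, (Finset.univ.filter fun c => E c = k).card =
      if (k : ℕ) + 1 = n then l else 1 := by
    intro k
    rw [← hw k]
    apply Finset.card_bij (fun c _ => c.1.2)
    · intro c hc
      have h1 := lt_card_of_mem lam (i := c.1.1) (j := c.1.2) c.2
      have h2 := hEmem c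
      rw [(Finset.mem_filter.1 hc).2] at h2
      simp only [Finset.mem_filter, Finset.mem_range]
      exact ⟨by omega, h2⟩
    · intro c hc d hd h
      exact hEinj c d h ((Finset.mem_filter.1 hc).2.trans (Finset.mem_filter.1 hd).2.symm)
    · intro j hj
      obtain ⟨c, hc, he⟩ := hEsurj j k (Finset.mem_filter.1 hj).2
      exact ⟨c, by simpa using he, hc⟩
  refine ⟨⟨E, hcontent, hEinj⟩, ?_, fun c d h => (hEeq c d h).2, fun hstd => ⟨fun c d h =>
    (hEeq c d h).2, ?_⟩⟩
  · ext j e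
    rw [Tab.mem_cols]
    refine ⟨?_, hEsurj j e⟩
    rintro ⟨c, rfl, rfl⟩
    exact hEmem c
  · intro c d hrow hcol
    by_contra hlt
    have hlt : E d < E c := not_le.1 hlt
    -- Count the letters at most `E d`: the column of `c` has at most as many as the row index of
    -- `c`, the column of `d` at least one more than this common row index. Being standard forbids
    -- this, as `c` lies to the left.
    have h1 := hstd ((E d : ℕ) + 1) hcol.le
    simp only [Nat.lt_succ_iff] at h1
    have h2 : ((C c.1.2).filter fun e : Fin n => (e : ℕ) ≤ E d).card ≤ c.1.1 := by
      conv_rhs => rw [← Finset.card_range c.1.1]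
      have hsub : ((C c.1.2).filter fun e : Fin n => (e : ℕ) ≤ E d) ⊆
          (Finset.univ.filter fun b : {c : ℕ × ℕ // c ∈ lam.cells} =>
            b.1.2 = c.1.2 ∧ b.1.1 < c.1.1).image E := by
        intro e he
        obtain ⟨he1, he2⟩ := Finset.mem_filter.1 he
        obtain ⟨b, hb, rfl⟩ := hEsurj _ _ he1
        refine Finset.mem_image.2 ⟨b, ?_, rfl⟩
        simp only [Finset.mem_filter, Finset.mem_univ, true_and]
        exact ⟨hb, (hEeq b c hb).1 (lt_of_le_of_lt (Fin.le_def.2 he2) hlt)⟩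
      refine (Finset.card_le_card hsub).trans (Finset.card_image_le.trans ?_)
      refine Finset.card_le_card_of_injOn (fun b => b.1.1) ?_ ?_
      · intro b hb
        simp only [Finset.coe_filter, Finset.mem_univ, true_and, Set.mem_ofPred_eq] at hb
        simpa using hb.2
      · intro b hb b' hb' h
        simp only [Finset.coe_filter, Finset.mem_univ, true_and, Set.mem_ofPred_eq] at hb hb'
        exact Subtype.ext (Prod.ext h (hb.1.trans hb'.1.symm))
    have h3 : d.1.1 + 1 ≤ ((C d.1.2).filter fun e : Fin n => (e : ℕ) ≤ E d).card := by
      conv_lhs => rw [← Finset.card_range (d.1.1 + 1)]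
      have hd : ∀ i ≤ d.1.1, (i, d.1.2) ∈ lam.cells := fun i hi =>
        lam.up_left_mem hi le_rfl d.2
      refine Finset.card_le_card_of_injOn
        (fun i => if hi : i ≤ d.1.1 then E ⟨(i, d.1.2), hd i hi⟩ else E d) ?_ ?_
      · intro i hi
        have hi : i ≤ d.1.1 := by simpa [Nat.lt_succ_iff] using hi
        simp only [dif_pos hi, Finset.coe_filter, Set.mem_ofPred_eq]
        refine ⟨hEmem ⟨(i, d.1.2), hd i hi⟩, ?_⟩
        rw [← Fin.le_def]
        by_contra hc
        have := (hEeq d ⟨(i, d.1.2), hd i hi⟩ rfl).1 (not_le.1 hc)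
        simp only at this
        omega
      · intro i hi i' hi' h
        have hi : i ≤ d.1.1 := by simpa [Nat.lt_succ_iff] using hi
        have hi' : i' ≤ d.1.1 := by simpa [Nat.lt_succ_iff] using hi'
        simp only [dif_pos hi, dif_pos hi'] at h
        have := hEinj ⟨(i, d.1.2), hd i hi⟩ ⟨(i', d.1.2), hd i' hi'⟩ rfl h
        simpa using this
    omega

theorem spechtIdeal_eq_colIdeal {B : ℕ} (hB : lam.card ≤ B) :
    spechtIdeal K n l lam =
      colIdeal K B lam.colLen fun e : Fin n => if (e : ℕ) + 1 = n then l else 1 := by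
  apply le_antisymm
  · refine Ideal.span_le.2 ?_
    rintro _ ⟨T, rfl⟩
    exact Ideal.mem_of_dvd _ (T.associated_specht K hB).dvd
      (Ideal.subset_span ⟨T.cols, T.card_cols, T.card_filter_mem_cols hB, rfl⟩)
  · refine Ideal.span_le.2 ?_
    rintro _ ⟨C, hC, hw, rfl⟩
    obtain ⟨T, hT, hinc, -⟩ := exists_tab hB hC hw
    exact Ideal.subset_span ⟨T, by rw [T.specht_eq_colPoly K hB hinc, hT]⟩

end Tableaux

end SpechtIdeals

/-! ### Conclusion -/

namespace SpechtIdeals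

open MvPolynomial

theorem tabWeight_eq_snoc (m l : ℕ) :
    (fun e : Fin (m + 1) => if (e : ℕ) + 1 = m + 1 then l else 1) =
      (Fin.snoc (fun _ => 1) l : Fin (m + 1) → ℕ) := by
  funext e
  induction e using Fin.lastCases with
  | last => simp
  | cast e => simp [e.2.ne]

/-- In a tableau with `l` copies of the last letter the first row has length at least `l`. -/
theorem Tab.le_rowLen {m l : ℕ} {lam : YoungDiagram} (T : Tab (m + 1) l lam) :
    l ≤ lam.rowLen 0 := by
  have h := T.card_filter_mem_cols le_rfl (Fin.last m)
  simp only [Fin.val_last, if_true] at h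
  rw [← h]
  conv_rhs => rw [← Finset.card_range (lam.rowLen 0)]
  refine Finset.card_le_card fun j hj => ?_
  have hpos := Finset.card_pos.2 ⟨_, (Finset.mem_filter.1 hj).2⟩
  rw [T.card_cols] at hpos
  exact Finset.mem_range.2 (lam.mem_iff_lt_rowLen.1 (lam.mem_iff_lt_colLen.2 hpos))

theorem initialMonomial_mem_span {K : Type*} [Field K] {n : ℕ} {f g : MvPolynomial (Fin n) K}
    {G : Set (MvPolynomial (Fin n) K)} (hg : g ∈ G)
    (h : (lexOrder n).degree g ≤ (lexOrder n).degree f) :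
    initialMonomial (lexOrder n) f ∈ Ideal.span (initialMonomial (lexOrder n) '' G) := by
  have : initialMonomial (lexOrder n) f =
      monomial ((lexOrder n).degree f - (lexOrder n).degree g) 1 *
        initialMonomial (lexOrder n) g := by
    rw [initialMonomial, initialMonomial, monomial_mul, tsub_add_cancel_of_le h, one_mul]
  rw [this]
  exact Ideal.mul_mem_left _ _ (Ideal.subset_span ⟨g, hg, rfl⟩)

end SpechtIdeals

open SpechtIdeals in
theorem mainTheorem3 {K : Type*} [Field K] [Infinite K] (n l : ℕ) (hn : 1 ≤ n) (hl : 1 ≤ l)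
    (lam : YoungDiagram) (hlam : lam ∈ SpechtIdeals.partitionsGE n l) :
    SpechtIdeals.IsGroebnerBasis (SpechtIdeals.lexOrder n)
      (SpechtIdeals.spechtIdeal K n l lam)
      {f | ∃ rho ∈ SpechtIdeals.partitionsGE n l, SpechtIdeals.Dominated rho lam ∧
        ∃ T : SpechtIdeals.Tab n l rho, T.IsStandard ∧ f = T.specht K} := by
  obtain ⟨m, rfl⟩ : ∃ m, n = m + 1 := ⟨n - 1, by omega⟩
  have hcard : ∀ {rho : YoungDiagram}, rho ∈ partitionsGE (m + 1) l → rho.card = m + l :=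
    fun h => by have := h.1; omega
  have hshape : ∀ {rho : YoungDiagram}, rho ∈ partitionsGE (m + 1) l →
      IsShape (m + l) (m + l) rho.colLen := fun h => by
    simpa only [hcard h] using isShape_colLen (hcard h).le
  have hmem : ∀ f ∈ {f | ∃ rho ∈ partitionsGE (m + 1) l, Dominated rho lam ∧
      ∃ T : Tab (m + 1) l rho, T.IsStandard ∧ f = T.specht K},
      f ∈ spechtIdeal K (m + 1) l lam ∧ f ≠ 0 ∧ ∃ C, f = colPoly K (m + l) C := by
    rintro _ ⟨rho, hrho, hd, T, hT, rfl⟩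
    rw [T.specht_eq_colPoly K (hcard hrho).le hT.col_strict,
      spechtIdeal_eq_colIdeal (hcard hlam).le]
    refine ⟨colPoly_mem_colIdeal (hshape hlam) (hshape hrho) ?_ T.card_cols
      (T.card_filter_mem_cols (hcard hrho).le), colPoly_ne_zero _ _, _, rfl⟩
    exact colDominated_of_dominated ((hcard hrho).trans (hcard hlam).symm) hd
  refine ⟨?_, fun g hg => (hmem g hg).2.1, fun g hg => (hmem g hg).1, le_antisymm ?_ ?_⟩
  -- Each element is determined by `m + l` subsets of a finite alphabet.
  · refine (Set.finite_range fun c : Fin (m + l) → Finset (Fin (m + 1)) =>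
      ∏ j, vandermondeProd K (c j)).subset fun f hf => ?_
    obtain ⟨-, -, C, rfl⟩ := hmem f hf
    exact ⟨fun j => C j, (Finset.prod_range fun j => vandermondeProd K (C j)).symm⟩
  · exact Ideal.span_mono (Set.image_mono fun g hg => ⟨(hmem g hg).1, (hmem g hg).2.1⟩)
  · refine Ideal.span_le.2 ?_
    rintro _ ⟨f, ⟨hf, hf0⟩, rfl⟩
    rw [spechtIdeal_eq_colIdeal (hcard hlam).le, tabWeight_eq_snoc] at hf
    obtain ⟨C, hstd, hCs, hCw, hCe⟩ :=
      hasStdDivisor_of_mem_colIdeal (Nat.le_add_right m l) (hshape hlam) hf hf0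
    obtain ⟨rho, hcol, hrho⟩ := exists_diagram hCs.1
    rw [← tabWeight_eq_snoc] at hCw
    obtain ⟨T, rfl, hinc, hT⟩ := exists_tab hrho.le (fun j => (congrFun hcol j).symm) hCw
    -- The bound `l ≤ rho.rowLen 0` does not come from dominance but from the `l` copies of the last
    -- letter, which occupy distinct columns of `T`.
    refine initialMonomial_mem_span (g := T.specht K)
      ⟨rho, ⟨by omega, T.le_rowLen⟩, ?_, T, hT hstd, rfl⟩ ?_
    · rw [dominated_iff_colDominated (hrho.trans (hcard hlam).symm), hcol]
      exact hCs.2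
    · rw [T.specht_eq_colPoly K hrho.le hinc, degree_colPoly]
      exact hCe
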